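/- All graphs are finite and simple. Graphs $G_1,\dots,G_m$ are \emph{nearly disjoint} if $|V(G_i)\cap V(G_j)|\le 1$ for all distinct $i,j$. A list assignment $L$ for a graph $G$ assigns a finite set $L(v)$ of colors to each vertex $v\in V(G)$; $G$ is \emph{$L$-colorable} if there is a proper coloring $\varphi$ of $G$ with $\varphi(v)\in L(v)$ for every $v\in V(G)$. The \emph{maximum color degree} of $G$ and $L$ is $$\Delta(G,L):=\max_{v\in V(G)}\max_{c\in L(v)}\bigl|\{u\in N_G(v): c\in L(u)\}\bigr|$$ (and $0$ if there is no such pair $(v,c)$). For all real numbers $C,\varepsilon>0$ there is $D_0$ such that the following holds for every real $D\ge D_0$. Let $G_1,\dots,G_m$ be graphs that (i) are nearly disjoint, and (ii) satisfy $|\{i\in\{1,\dots,m\}: v\in V(G_i)\}|\le C$ for every $v\in\bigcup_{i=1}^m V(G_i)$. If $L$ is a list assignment for $G:=\bigcup_{i=1}^m G_i$ satisfying (iii) $\Delta(G_i, L|_{V(G_i)})\le D$ for every $i\in\{1,\dots,m\}$, and (iv) $|L(v)|\ge(1+\varepsilon)D$ for every $v\in V(G)$, then $G$ is $L$-colorable.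 -/

import Mathlib

/-- A finite graph whose vertex set `H.verts` is a subset of `V` is encoded as a subgraph `H` of
the complete graph on `V`. For a list assignment `L`, this is the color degree
`d_{H,L}(v,c) = |{u ∈ N_H(v) : c ∈ L(u)}|`. Only the values of `L` on `H.verts` matter. -/
noncomputable def colorDegree {V α : Type*} (H : (⊤ : SimpleGraph V).Subgraph)
    (L : V → Finset α) (v : V) (c : α) : ℕ :=
  {u ∈ H.neighborSet v | c ∈ L u}.ncard

/-- The maximum color degree `Δ(H,L) = max_{v ∈ V(H)} max_{c ∈ L(v)} d_{H,L}(v,c)`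
of a finite graph `H` (equal to `0` if there is no such pair `(v,c)`). -/
noncomputable def maxColorDegree {V α : Type*} (H : (⊤ : SimpleGraph V).Subgraph)
    (L : V → Finset α) : ℕ :=
  sSup {d : ℕ | ∃ v ∈ H.verts, ∃ c ∈ L v, d = colorDegree H L v c}

/-- Any two distinct members of the family share at most one vertex. -/
def NearlyDisjoint {V ι : Type*} (G : ι → (⊤ : SimpleGraph V).Subgraph) : Prop :=
  ∀ i j, i ≠ j → ((G i).verts ∩ (G j).verts).encard ≤ 1

/-- `H` is `L`-colorable: it has a proper coloring giving each vertex a color of its list. -/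
def IsListColorable {V α : Type*} (H : (⊤ : SimpleGraph V).Subgraph) (L : V → Finset α) : Prop :=
  ∃ φ : H.coe.Coloring α, ∀ v : H.verts, φ v ∈ L v

/-! The proof is a semi-random "nibble". A union of `N` graphs may have color degree `N * d`, far
above the list size `ℓ`, so the local lemma alone fails; it succeeds only when `ℓ ≥ 32 * N * d`
(`IsBounded.colorable_of_sparse`). The nibble raises the ratio of `ℓ` to `d` until that holds.

In one step every vertex selects each color independently with probability `q = p / ℓ`. A color
survives at a vertex if no neighbour in any of the graphs selects it, and a vertex that selects a
surviving color is colored with it. The other vertices keep surviving colors only, so colored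
vertices cause no later conflict. Artificial `pad` bits make each color survive with probability
exactly `(1 - q) ^ (N * d)`, which is the factor by which lists shrink.

A neighbour `u` of `v` in the `i`-th graph still counts toward the color degree of `c` if it stays
uncolored and keeps `c`. Conflicts inside graph `i` are too correlated to use (in a clique one
selection of `c` removes it everywhere), so only survival in the other graphs is counted, giving `(1
- q) ^ (N * d - d)`. Remaining uncolored gives a further `(1 - q) ^ ℓ ≈ 1 - p`, up to an `O(N * p ^
2 * d)` error from spoiled selections. Lists lose instead the further factor `(1 - q) ^ d ≥ 1 - p *
d / ℓ`, and `d / ℓ ≤ 1 / (1 + ε)`. Hence the degrees shrink faster, and for small `p` the ratio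
gains a factor `1 + p ^ 2` (`nextDegree_nextList_bounds`). A bounded number of steps suffices.

Near disjointness supplies concentration: another graph through a vertex `w` meets graph `i` in at
most one vertex, so a bit of `w` influences at most `N` of the neighbours considered
(`card_mem_outerBits_le`). The bad events then have probability exponentially small in `d`, and the
local lemma avoids all of them (`IsBounded.exists_forall_not_bad`). -/

section

open Finset Function
open scoped Classical

/-! ### Expectations over finite product spaces -/

/-- A family of probability weights on the finite type `K`, one for each coordinate `b : B`. -/
structure IsWeight {B K : Type*} [Fintype K] (w : B → K → ℝ) : Prop where
  nonneg : ∀ b k, 0 ≤ w b k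
  sum_eq_one : ∀ b, ∑ k, w b k = 1

/-- The expectation of `f` when the coordinates are chosen independently according to `w`. -/
noncomputable def prodExp {B K : Type*} [Fintype B] [Fintype K] (w : B → K → ℝ)
    (f : (B → K) → ℝ) : ℝ :=
  ∑ ω : B → K, (∏ b, w b (ω b)) * f ω

/-- The average of `f` over the coordinate `b`. -/
noncomputable def coordAvg {B K : Type*} [Fintype K] (w : B → K → ℝ) (b : B)
    (f : (B → K) → ℝ) (ω : B → K) : ℝ :=
  ∑ k, w b k * f (update ω b k)

/-- The probability of the event `P`. -/
noncomputable def prodProb {B K : Type*} [Fintype B] [Fintype K] (w : B → K → ℝ)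
    (P : (B → K) → Prop) : ℝ :=
  prodExp w (fun ω => if P ω then 1 else 0)

lemma dependsOn_coordAvg {B K : Type*} [Fintype K] {w : B → K → ℝ} {f : (B → K) → ℝ} {b : B} {s : Finset B}
    (hf : DependsOn f (insert b s : Finset B)) : DependsOn (coordAvg w b f) (s : Set B) := by
  intro x y hxy
  refine sum_congr rfl fun k _ => ?_
  congr 1
  refine hf fun i hi => ?_
  by_cases h : i = b
  · subst h; simp
  · rw [update_of_ne h, update_of_ne h]
    exact hxy i (by simpa [h] using hi)

lemma dependsOn_prod {B K ι : Type*} (I : Finset ι) (s : ι → Finset B) {f : ι → (B → K) → ℝ}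
    (hf : ∀ i ∈ I, DependsOn (f i) (s i : Set B)) :
    DependsOn (fun ω => ∏ i ∈ I, f i ω) (I.biUnion s : Set B) := by
  intro x y hxy
  exact prod_congr rfl fun i hi => hf i hi fun b hb => hxy b (by
    simp only [Set.mem_iUnion, coe_biUnion]; exact ⟨i, hi, hb⟩)

lemma dependsOn_indicator {B K : Type*} {P : (B → K) → Prop} {s : Set B} (hP : DependsOn P s) :
    DependsOn (fun ω => if P ω then (1 : ℝ) else 0) s := by
  intro x y hxy
  simp only [hP hxy]

section Basic

variable {B K : Type*} [Fintype B] [Fintype K] {w : B → K → ℝ}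

lemma prodExp_prod (g : B → K → ℝ) :
    prodExp w (fun ω => ∏ b, g b (ω b)) = ∏ b, ∑ k, w b k * g b k := by
  simp only [prodExp, ← prod_mul_distrib]
  rw [Finset.prod_univ_sum]
  simp

lemma prodExp_const (hw : IsWeight w) (a : ℝ) : prodExp w (fun _ => a) = a := by
  have h := prodExp_prod (w := w) (fun _ _ => 1)
  simp only [prodExp, mul_one, prod_const_one, hw.sum_eq_one] at h
  simp [prodExp, ← sum_mul, h]

lemma prodExp_mono (hw : IsWeight w) {f g : (B → K) → ℝ} (h : ∀ ω, f ω ≤ g ω) :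
    prodExp w f ≤ prodExp w g :=
  sum_le_sum fun ω _ => mul_le_mul_of_nonneg_left (h ω) (prod_nonneg fun b _ => hw.nonneg b _)

lemma prodExp_nonneg (hw : IsWeight w) {f : (B → K) → ℝ} (h : ∀ ω, 0 ≤ f ω) :
    0 ≤ prodExp w f :=
  sum_nonneg fun ω _ => mul_nonneg (prod_nonneg fun b _ => hw.nonneg b _) (h ω)

lemma prodExp_add (f g : (B → K) → ℝ) :
    prodExp w (fun ω => f ω + g ω) = prodExp w f + prodExp w g := by
  simp [prodExp, mul_add, sum_add_distrib]

lemma prodExp_sum {ι : Type*} (s : Finset ι) (f : ι → (B → K) → ℝ) :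
    prodExp w (fun ω => ∑ i ∈ s, f i ω) = ∑ i ∈ s, prodExp w (f i) := by
  simp only [prodExp, mul_sum]
  rw [sum_comm]

lemma prodExp_const_mul (a : ℝ) (f : (B → K) → ℝ) :
    prodExp w (fun ω => a * f ω) = a * prodExp w f := by
  simp only [prodExp, mul_sum]
  exact sum_congr rfl fun _ _ => by ring

lemma prodExp_mul_const (a : ℝ) (f : (B → K) → ℝ) :
    prodExp w (fun ω => f ω * a) = prodExp w f * a := by
  simp only [mul_comm _ a, prodExp_const_mul]

/-- Exchanging the coordinate `ω b` with a fresh sample `k` is a weight-preserving involution of the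
pairs `(ω, k)`; after the exchange the fresh sample sums out to 1. -/
lemma prodExp_coordAvg (hw : IsWeight w) (b : B) (f : (B → K) → ℝ) :
    prodExp w (coordAvg w b f) = prodExp w f := by
  have key : ∀ (ω : B → K) (k : K), (∏ x, w x (ω x)) * w b k
      = (∏ x, w x (update ω b k x)) * w b (ω b) := by
    intro ω k
    rw [← mul_prod_erase univ _ (mem_univ b), ← mul_prod_erase univ
      (fun x => w x (update ω b k x)) (mem_univ b)]
    have : ∏ x ∈ univ.erase b, w x (update ω b k x) = ∏ x ∈ univ.erase b, w x (ω x) :=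
      prod_congr rfl fun x hx => by rw [update_of_ne (ne_of_mem_erase hx)]
    rw [this, update_self]
    ring
  have inv : Involutive (fun z : (B → K) × K => (update z.1 b z.2, z.1 b)) := by
    rintro ⟨ω, k⟩
    simp
  calc prodExp w (coordAvg w b f)
      = ∑ z : (B → K) × K, (∏ x, w x (z.1 x)) * w b z.2 * f (update z.1 b z.2) := by
        simp only [prodExp, coordAvg, mul_sum, Fintype.sum_prod_type, mul_assoc]
    _ = ∑ z : (B → K) × K, (∏ x, w x (update z.1 b z.2 x)) * w b (z.1 b)
          * f (update z.1 b z.2) :=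
        sum_congr rfl fun z _ => by rw [key]
    _ = ∑ z : (B → K) × K, (∏ x, w x (z.1 x)) * w b z.2 * f z.1 :=
        Equiv.sum_comp inv.toPerm
          (fun z : (B → K) × K => (∏ x, w x (z.1 x)) * w b z.2 * f z.1)
    _ = prodExp w f := by
        rw [Fintype.sum_prod_type, prodExp]
        refine sum_congr rfl fun ω _ => ?_
        simp only [mul_right_comm _ _ (f ω)]
        rw [← mul_sum, hw.sum_eq_one, mul_one]

/-- Functions of disjoint sets of coordinates are uncorrelated. -/
lemma prodExp_mul_of_dependsOn (hw : IsWeight w) {s t : Finset B} (hst : Disjoint s t)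
    {f g : (B → K) → ℝ} (hf : DependsOn f (s : Set B)) (hg : DependsOn g (t : Set B)) :
    prodExp w (fun ω => f ω * g ω) = prodExp w f * prodExp w g := by
  induction s using Finset.induction_on generalizing f with
  | empty =>
    by_cases h : Nonempty (B → K)
    · obtain ⟨ω₀⟩ := h
      have : f = fun _ => f ω₀ := funext fun x => hf fun i hi => by simp at hi
      rw [this, prodExp_const hw, prodExp_const_mul]
    · rw [not_nonempty_iff] at h
      simp [prodExp]
  | insert b s hb ih =>
    rw [disjoint_insert_left] at hst
    rw [← prodExp_coordAvg hw b, ← prodExp_coordAvg hw b f,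
      ← ih hst.2 (dependsOn_coordAvg hf)]
    congr 1
    funext ω
    simp only [coordAvg, sum_mul]
    refine sum_congr rfl fun k _ => ?_
    have : g (update ω b k) = g ω := hg fun i hi => by
      rw [update_of_ne]
      rintro rfl
      exact hst.1 (by simpa using hi)
    rw [this, mul_assoc]

/-- Functions of pairwise disjoint sets of coordinates: the expectation of the product is the
product of the expectations. -/
lemma prodExp_prod_of_dependsOn (hw : IsWeight w) {ι : Type*} (I : Finset ι) (s : ι → Finset B)
    (hs : (I : Set ι).PairwiseDisjoint s) {f : ι → (B → K) → ℝ}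
    (hf : ∀ i ∈ I, DependsOn (f i) (s i : Set B)) :
    prodExp w (fun ω => ∏ i ∈ I, f i ω) = ∏ i ∈ I, prodExp w (f i) := by
  induction I using Finset.induction_on with
  | empty => simp [prodExp_const hw]
  | insert i I hi ih =>
    simp only [prod_insert hi]
    rw [prodExp_mul_of_dependsOn hw (s := s i) (t := I.biUnion s) _ (hf i (by simp))
      (by simpa using dependsOn_prod I s fun j hj => hf j (by simp [hj])),
      ih (hs.subset (by simp)) fun j hj => hf j (by simp [hj])]
    rw [disjoint_biUnion_right]
    intro j hj
    exact hs (by simp) (by simp [hj]) (by rintro rfl; exact hi hj)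

lemma prodProb_mono (hw : IsWeight w) {P Q : (B → K) → Prop} (h : ∀ ω, P ω → Q ω) :
    prodProb w P ≤ prodProb w Q := by
  refine prodExp_mono hw fun ω => ?_
  by_cases hP : P ω
  · simp [hP, h ω hP]
  · simp only [hP, if_false]; split_ifs <;> simp

lemma prodProb_nonneg (hw : IsWeight w) (P : (B → K) → Prop) : 0 ≤ prodProb w P :=
  prodExp_nonneg hw fun ω => by split_ifs <;> simp

lemma prodProb_or_le (hw : IsWeight w) (P Q : (B → K) → Prop) :
    prodProb w (fun ω => P ω ∨ Q ω) ≤ prodProb w P + prodProb w Q := by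
  rw [prodProb, prodProb, prodProb, ← prodExp_add]
  refine prodExp_mono hw fun ω => ?_
  by_cases hP : P ω <;> by_cases hQ : Q ω <;> simp [hP, hQ]

lemma prodProb_exists_le (hw : IsWeight w) {ι : Type*} (I : Finset ι)
    (P : ι → (B → K) → Prop) :
    prodProb w (fun ω => ∃ i ∈ I, P i ω) ≤ ∑ i ∈ I, prodProb w (P i) := by
  simp only [prodProb]
  rw [← prodExp_sum]
  refine prodExp_mono hw fun ω => ?_
  split_ifs with h
  · obtain ⟨i, hi, hP⟩ := h
    have := single_le_sum (f := fun i => if P i ω then (1 : ℝ) else 0)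
      (fun j _ => by split_ifs <;> simp) hi
    simpa [hP] using this
  · exact sum_nonneg fun j _ => by split_ifs <;> simp

/-- Markov's inequality for exponential moments. -/
lemma prodProb_le_exp_mul (hw : IsWeight w) (f : (B → K) → ℝ) (a : ℝ) :
    prodProb w (fun ω => a ≤ f ω) ≤ Real.exp (-a) * prodExp w (fun ω => Real.exp (f ω)) := by
  rw [← prodExp_const_mul]
  refine prodExp_mono hw fun ω => ?_
  rw [← Real.exp_add]
  split_ifs with h
  · exact Real.one_le_exp (by linarith)
  · positivity

/-! ### The symmetric local lemma -/

/-- The inductive core of the local lemma, a conditional probability bound multiplied out so that no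
division by a possibly zero probability occurs. -/
lemma prodProb_and_forall_not_le (hw : IsWeight w) {ι : Type*} [Fintype ι] (A : ι → (B → K) → Prop)
    (s : ι → Finset B) (hA : ∀ i, DependsOn (A i) (s i : Set B)) (π : ℝ) (Δ : ℕ)
    (hπ : ∀ i, prodProb w (A i) ≤ π)
    (hΔ : ∀ i, #{j | ¬ Disjoint (s i) (s j)} ≤ Δ) (h : 4 * π * Δ ≤ 1) (n : ℕ) :
    ∀ (T : Finset ι) (i : ι), #T ≤ n →
      prodProb w (fun ω => A i ω ∧ ∀ j ∈ T, ¬ A j ω)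
        ≤ 2 * π * prodProb w (fun ω => ∀ j ∈ T, ¬ A j ω) := by
  induction n with
  | zero =>
    intro T i hT
    obtain rfl : T = ∅ := by simpa using hT
    have h1 : prodProb w (fun _ => True) = 1 := by simp [prodProb, prodExp_const hw]
    have h0 := (prodProb_nonneg hw (A i)).trans (hπ i)
    simp only [notMem_empty, false_imp_iff, implies_true, and_true, h1]
    linarith [hπ i]
  | succ n ih =>
    intro T i hT
    have h0 := (prodProb_nonneg hw (A i)).trans (hπ i)
    set T₁ := T.filter fun j => ¬ Disjoint (s i) (s j) with hT₁
    set T₂ := T.filter fun j => Disjoint (s i) (s j) with hT₂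
    have hind : prodProb w (fun ω => A i ω ∧ ∀ j ∈ T₂, ¬ A j ω)
        = prodProb w (A i) * prodProb w (fun ω => ∀ j ∈ T₂, ¬ A j ω) := by
      simp only [prodProb]
      rw [← prodExp_mul_of_dependsOn hw (s := s i) (t := T₂.biUnion s)]
      · congr 1
        funext ω
        by_cases h1 : A i ω <;> simp [h1]
      · rw [disjoint_biUnion_right]
        intro j hj
        exact (mem_filter.1 hj).2
      · exact dependsOn_indicator (hA i)
      · refine dependsOn_indicator fun x y hxy => propext (forall₂_congr fun j hj => ?_)
        rw [hA j fun b hb => hxy b (by simp only [coe_biUnion, Set.mem_iUnion]; exact ⟨j, hj, hb⟩)]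
    have hle : prodProb w (fun ω => A i ω ∧ ∀ j ∈ T, ¬ A j ω)
        ≤ π * prodProb w (fun ω => ∀ j ∈ T₂, ¬ A j ω) := by
      calc _ ≤ prodProb w (fun ω => A i ω ∧ ∀ j ∈ T₂, ¬ A j ω) :=
            prodProb_mono hw fun ω hω => ⟨hω.1, fun j hj => hω.2 j (mem_filter.1 hj).1⟩
        _ ≤ _ := by
            rw [hind]
            exact mul_le_mul_of_nonneg_right (hπ i) (prodProb_nonneg hw _)
    refine hle.trans ?_
    have hT₂0 := prodProb_nonneg hw (fun ω => ∀ j ∈ T₂, ¬ A j ω)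
    -- Conditioning on the dependent events `T₁` costs at most a factor 2: by induction they remove
    -- at most the fraction `Δ * 2 * π ≤ 1 / 2` of the event for `T₂`. The induction applies only if
    -- `T₂` is smaller than `T`, hence the case split on `T₁`.
    suffices hs : prodProb w (fun ω => ∀ j ∈ T₂, ¬ A j ω)
        ≤ 2 * prodProb w (fun ω => ∀ j ∈ T, ¬ A j ω) by nlinarith
    rcases T₁.eq_empty_or_nonempty with he | hne
    · have : T₂ = T := by
        rw [hT₂, filter_eq_self]
        intro j hj
        by_contra hc
        have : j ∈ T₁ := mem_filter.2 ⟨hj, hc⟩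
        simp [he] at this
      rw [this] at hT₂0 ⊢
      linarith
    · have hcard : #T₂ ≤ n := by
        have h1 : #T₂ + #T₁ = #T := card_filter_add_card_filter_not _
        have h2 := hne.card_pos
        omega
      have hsplit : prodProb w (fun ω => ∀ j ∈ T₂, ¬ A j ω)
          ≤ prodProb w (fun ω => ∀ j ∈ T, ¬ A j ω)
            + ∑ j ∈ T₁, prodProb w (fun ω => A j ω ∧ ∀ k ∈ T₂, ¬ A k ω) := by
        refine le_trans (prodProb_mono hw fun ω hω => ?_)
          ((prodProb_or_le hw _ _).trans (add_le_add le_rfl (prodProb_exists_le hw T₁ _)))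
        by_cases hc : ∃ j ∈ T₁, A j ω
        · obtain ⟨j, hj, hAj⟩ := hc
          exact Or.inr ⟨j, hj, hAj, hω⟩
        · push Not at hc
          refine Or.inl fun j hj => ?_
          by_cases hd : Disjoint (s i) (s j)
          · exact hω j (mem_filter.2 ⟨hj, hd⟩)
          · exact hc j (mem_filter.2 ⟨hj, hd⟩)
      have hsum : ∑ j ∈ T₁, prodProb w (fun ω => A j ω ∧ ∀ k ∈ T₂, ¬ A k ω)
          ≤ Δ * (2 * π * prodProb w (fun ω => ∀ j ∈ T₂, ¬ A j ω)) := by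
        refine (sum_le_card_nsmul T₁ _ _ fun j _ => ih T₂ j hcard).trans ?_
        rw [nsmul_eq_mul]
        refine mul_le_mul_of_nonneg_right ?_ (by positivity)
        exact_mod_cast (card_le_card (filter_subset_filter _ (subset_univ T))).trans (hΔ i)
      nlinarith

/-- The symmetric Lovász local lemma on a finite product space. -/
theorem exists_forall_not_of_localLemma (hw : IsWeight w) {ι : Type*} [Fintype ι]
    (A : ι → (B → K) → Prop) (s : ι → Finset B) (hA : ∀ i, DependsOn (A i) (s i : Set B))
    (π : ℝ) (Δ : ℕ) (hπ : ∀ i, prodProb w (A i) ≤ π)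
    (hΔ : ∀ i, #{j | ¬ Disjoint (s i) (s j)} ≤ Δ) (hΔ1 : 1 ≤ Δ) (h : 4 * π * Δ ≤ 1) :
    ∃ ω : B → K, (∀ b, 0 < w b (ω b)) ∧ ∀ i, ¬ A i ω := by
  have hpos : ∀ T : Finset ι, 0 < prodProb w (fun ω => ∀ j ∈ T, ¬ A j ω) := by
    intro T
    induction T using Finset.induction_on with
    | empty => simp [prodProb, prodExp_const hw]
    | insert i T hi ih =>
      have h0 := (prodProb_nonneg hw (A i)).trans (hπ i)
      have h1 := prodProb_and_forall_not_le hw A s hA π Δ hπ hΔ h #T T i le_rfl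
      have h2 : prodProb w (fun ω => ∀ j ∈ T, ¬ A j ω)
          ≤ prodProb w (fun ω => ∀ j ∈ insert i T, ¬ A j ω)
            + prodProb w (fun ω => A i ω ∧ ∀ j ∈ T, ¬ A j ω) := by
        refine le_trans (prodProb_mono hw fun ω hω => ?_) (prodProb_or_le hw _ _)
        by_cases hc : A i ω
        · exact Or.inr ⟨hc, hω⟩
        · refine Or.inl fun j hj => ?_
          rcases mem_insert.1 hj with rfl | hj
          · exact hc
          · exact hω j hj
      have h3 : (1 : ℝ) ≤ Δ := by exact_mod_cast hΔ1
      have h4 : 4 * π ≤ 1 := by nlinarith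
      nlinarith
  have hu := hpos univ
  by_contra! hcon
  refine hu.ne' (sum_eq_zero fun ω _ => ?_)
  by_cases hb : ∀ b, 0 < w b (ω b)
  · obtain ⟨i, hi⟩ := hcon ω hb
    exact mul_eq_zero_of_right _ (if_neg fun h => h i (mem_univ i) hi)
  · push Not at hb
    obtain ⟨b, hb⟩ := hb
    rw [prod_eq_zero (mem_univ b) (le_antisymm hb (hw.nonneg b _)), zero_mul]

end Basic

/-! ### Independent bits -/

/-- Every bit is `true` with probability `q`. -/
def bitWeight (B : Type*) (q : ℝ) : B → Bool → ℝ := fun _ k => if k then q else 1 - q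

lemma isWeight_bitWeight (B : Type*) {q : ℝ} (h0 : 0 ≤ q) (h1 : q ≤ 1) :
    IsWeight (bitWeight B q) where
  nonneg b k := by cases k <;> simp [bitWeight, h0, h1]
  sum_eq_one b := by simp [bitWeight]

/-- Center at the mean and use `exp z ≤ 1 + z + z ^ 2` for `|z| ≤ 1`. The factor `q` in the error is
the gain from the small variance of a rare bit; a Hoeffding bound without it would be too weak,
since there are order `d * ℓ` bits with `q = p / ℓ`. -/
lemma two_point_exp_le {q x y a : ℝ} (h0 : 0 ≤ q) (h1 : q ≤ 1) (hxy : |x - y| ≤ a) (ha : a ≤ 1) :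
    q * Real.exp x + (1 - q) * Real.exp y ≤ Real.exp (q * x + (1 - q) * y + q * a ^ 2) := by
  have hb : ∀ z : ℝ, |z| ≤ 1 → Real.exp z ≤ 1 + z + z ^ 2 := fun z hz => by
    linarith [(abs_le.1 (Real.abs_exp_sub_one_sub_id_le hz)).2]
  set m := q * x + (1 - q) * y with hm
  have hd : |x - y| ≤ 1 := hxy.trans ha
  have e1 : Real.exp x ≤ Real.exp m * (1 + (1 - q) * (x - y) + ((1 - q) * (x - y)) ^ 2) := by
    have hx : x = m + (1 - q) * (x - y) := by rw [hm]; ring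
    conv_lhs => rw [hx, Real.exp_add]
    refine mul_le_mul_of_nonneg_left (hb _ ?_) (Real.exp_pos _).le
    rw [abs_mul, abs_of_nonneg (by linarith : 0 ≤ 1 - q)]
    nlinarith [abs_nonneg (x - y)]
  have e2 : Real.exp y ≤ Real.exp m * (1 + -q * (x - y) + (-q * (x - y)) ^ 2) := by
    have hy : y = m + -q * (x - y) := by rw [hm]; ring
    conv_lhs => rw [hy, Real.exp_add]
    refine mul_le_mul_of_nonneg_left (hb _ ?_) (Real.exp_pos _).le
    rw [abs_mul, abs_neg, abs_of_nonneg h0]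
    nlinarith [abs_nonneg (x - y)]
  have hsq : (x - y) ^ 2 ≤ a ^ 2 := sq_le_sq' (by linarith [(abs_le.1 hxy).1]) (abs_le.1 hxy).2
  rw [Real.exp_add]
  have e3 : 1 + q * (x - y) ^ 2 ≤ Real.exp (q * a ^ 2) := by
    nlinarith [Real.add_one_le_exp (q * a ^ 2), mul_le_mul_of_nonneg_left hsq h0]
  have hpos := Real.exp_pos m
  calc q * Real.exp x + (1 - q) * Real.exp y
      ≤ q * (Real.exp m * (1 + (1 - q) * (x - y) + ((1 - q) * (x - y)) ^ 2))
        + (1 - q) * (Real.exp m * (1 + -q * (x - y) + (-q * (x - y)) ^ 2)) :=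
        add_le_add (mul_le_mul_of_nonneg_left e1 h0)
          (mul_le_mul_of_nonneg_left e2 (by linarith))
    _ = Real.exp m * (1 + q * (1 - q) * (x - y) ^ 2) := by ring
    _ ≤ Real.exp m * (1 + q * (x - y) ^ 2) := by
        refine mul_le_mul_of_nonneg_left ?_ hpos.le
        nlinarith [mul_nonneg (mul_nonneg h0 h0) (sq_nonneg (x - y))]
    _ ≤ _ := mul_le_mul_of_nonneg_left e3 hpos.le

lemma coordAvg_bitWeight {B : Type*} {q : ℝ} (b : B) (f : (B → Bool) → ℝ) (ω : B → Bool) :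
    coordAvg (bitWeight B q) b f ω
      = q * f (update ω b true) + (1 - q) * f (update ω b false) := by
  simp [coordAvg, bitWeight]

/-- The indices `u ∈ A` for which all bits in `R u` are `false`. -/
noncomputable def zeroSet {B U : Type*} (A : Finset U) (R : U → Finset B) (ω : B → Bool) :
    Finset U :=
  {u ∈ A | ∀ b ∈ R u, ω b = false}

lemma mem_zeroSet {B U : Type*} {A : Finset U} {R : U → Finset B} {ω : B → Bool} {u : U} :
    u ∈ zeroSet A R ω ↔ u ∈ A ∧ ∀ b ∈ R u, ω b = false :=
  mem_filter

/-- The number of indices `u ∈ A` for which all bits in `R u` are `false`. -/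
noncomputable def zeroCount {B U : Type*} (A : Finset U) (R : U → Finset B) (ω : B → Bool) : ℕ :=
  #(zeroSet A R ω)

/-- Turning `b` on can only remove indices, and only those `u` with `b ∈ R u`. -/
lemma abs_zeroCount_update_sub_le {B U : Type*} (A : Finset U) (R : U → Finset B) {k : ℕ} (b : B)
    (hk : #{u ∈ A | b ∈ R u} ≤ k) (ω : B → Bool) :
    |(zeroCount A R (update ω b true) : ℝ) - zeroCount A R (update ω b false)| ≤ k := by
  have h1 : zeroCount A R (update ω b true) ≤ zeroCount A R (update ω b false) := by
    refine card_le_card (monotone_filter_right A fun u _ hu x hx => ?_)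
    have := hu x hx
    by_cases hxb : x = b
    · subst hxb; simp
    · rwa [update_of_ne hxb] at this ⊢
  have h2 : zeroCount A R (update ω b false) ≤ zeroCount A R (update ω b true) + k := by
    refine le_trans (card_le_card ?_) ((card_union_le _ _).trans (add_le_add le_rfl hk))
    intro u hu
    rw [mem_zeroSet] at hu
    rw [mem_union, mem_zeroSet, mem_filter]
    by_cases hb : b ∈ R u
    · exact Or.inr ⟨hu.1, hb⟩
    · refine Or.inl ⟨hu.1, fun x hx => ?_⟩
      have hne : x ≠ b := by rintro rfl; exact hb hx
      have := hu.2 x hx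
      rwa [update_of_ne hne] at this ⊢
  have h1' : (zeroCount A R (update ω b true) : ℝ) ≤ zeroCount A R (update ω b false) := by
    exact_mod_cast h1
  have h2' : (zeroCount A R (update ω b false) : ℝ) ≤ zeroCount A R (update ω b true) + k := by
    exact_mod_cast h2
  rw [abs_le]
  constructor <;> linarith

lemma dependsOn_zeroCount {B U : Type*} (A : Finset U) (R : U → Finset B) :
    DependsOn (zeroCount A R) {b | ∃ u ∈ A, b ∈ R u} := by
  intro x y hxy
  refine congrArg card (filter_congr fun u hu => forall₂_congr fun b hb => ?_)
  rw [hxy b ⟨u, hu, hb⟩]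

section Bits

variable {B : Type*} [Fintype B] {q : ℝ}

/-- The exponential moment of a function of independent bits that changes by at most `a ≤ 1`
when a bit is changed. -/
lemma prodExp_exp_le_of_bounded_differences (h0 : 0 ≤ q) (h1 : q ≤ 1) {a : ℝ} (ha : a ≤ 1)
    (s : Finset B) {f : (B → Bool) → ℝ} (hf : DependsOn f (s : Set B))
    (hd : ∀ b ∈ s, ∀ ω, |f (update ω b true) - f (update ω b false)| ≤ a) :
    prodExp (bitWeight B q) (fun ω => Real.exp (f ω))
      ≤ Real.exp (prodExp (bitWeight B q) f + q * a ^ 2 * #s) := by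
  have hw := isWeight_bitWeight B h0 h1
  induction s using Finset.induction_on generalizing f with
  | empty =>
    have : f = fun _ => f (fun _ => true) := funext fun x => hf fun i hi => by simp at hi
    rw [this, prodExp_const hw, prodExp_const hw]
    simp
  | insert b s hb ih =>
    -- Averaging out one bit preserves the difference bound for the others, so bits can be
    -- integrated one at a time, each costing `q * a ^ 2` in the exponent.
    have hg : ∀ b' ∈ s, ∀ ω, |coordAvg (bitWeight B q) b f (update ω b' true)
        - coordAvg (bitWeight B q) b f (update ω b' false)| ≤ a := by
      intro b' hb' ω
      have hne : b' ≠ b := by rintro rfl; exact hb hb'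
      rw [coordAvg_bitWeight, coordAvg_bitWeight, update_comm hne, update_comm hne,
        update_comm hne, update_comm hne]
      have i1 := hd b' (mem_insert_of_mem hb') (update ω b true)
      have i2 := hd b' (mem_insert_of_mem hb') (update ω b false)
      rw [abs_le] at i1 i2 ⊢
      constructor <;> nlinarith
    have hih := ih (dependsOn_coordAvg (w := bitWeight B q) hf) hg
    rw [prodExp_coordAvg hw] at hih
    rw [← prodExp_coordAvg hw b, card_insert_of_notMem hb]
    calc _ ≤ prodExp (bitWeight B q) (fun ω => Real.exp (coordAvg (bitWeight B q) b f ω)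
            * Real.exp (q * a ^ 2)) := by
          refine prodExp_mono hw fun ω => ?_
          rw [coordAvg_bitWeight, coordAvg_bitWeight, ← Real.exp_add]
          exact two_point_exp_le h0 h1 (hd b (mem_insert_self b s) ω) ha
      _ ≤ _ := by
          rw [prodExp_mul_const]
          refine (mul_le_mul_of_nonneg_right hih (Real.exp_pos _).le).trans_eq ?_
          rw [← Real.exp_add]
          congr 1
          push_cast
          ring

lemma prodProb_forall_false (S : Finset B) :
    prodProb (bitWeight B q) (fun ω => ∀ b ∈ S, ω b = false) = (1 - q) ^ #S := by
  have h := prodExp_prod (w := bitWeight B q)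
    (fun b k => if b ∈ S then (if k then (0 : ℝ) else 1) else 1)
  have h2 : ∀ b, ∑ k, bitWeight B q b k * (if b ∈ S then (if k then (0 : ℝ) else 1) else 1)
      = if b ∈ S then 1 - q else 1 := by
    intro b
    by_cases hb : b ∈ S <;> simp [hb, bitWeight]
  simp only [h2] at h
  rw [prod_ite_mem, univ_inter, prod_const] at h
  rw [← h, prodProb]
  congr 1
  funext ω
  rw [prod_ite_mem, univ_inter]
  split_ifs with hP
  · rw [prod_congr rfl (g := fun _ => (1 : ℝ)) fun b hb => by simp [hP b hb]]
    simp
  · push Not at hP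
    obtain ⟨b, hb, hb'⟩ := hP
    exact (prod_eq_zero hb (by simpa using hb')).symm

lemma prodExp_zeroCount {U : Type*} (A : Finset U) (R : U → Finset B) :
    prodExp (bitWeight B q) (fun ω => (zeroCount A R ω : ℝ)) = ∑ u ∈ A, (1 - q) ^ #(R u) := by
  simp only [zeroCount, zeroSet, card_filter, Nat.cast_sum, Nat.cast_ite, Nat.cast_one, Nat.cast_zero]
  rw [prodExp_sum]
  refine sum_congr rfl fun u _ => ?_
  rw [← prodProb_forall_false, prodProb]
  congr 1
  funext ω
  congr

/-- Allowing either sign of `t` yields both tails. At most `#A * M` bits matter, the size bound for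
the union of the sets `R u`. -/
lemma prodExp_exp_zeroCount_le (h0 : 0 ≤ q) (h1 : q ≤ 1) {U : Type*} (A : Finset U)
    (R : U → Finset B) {k M : ℕ} (hk : ∀ b, #{u ∈ A | b ∈ R u} ≤ k) (hM : ∀ u ∈ A, #(R u) ≤ M)
    {t : ℝ} (ht : |t| * k ≤ 1) :
    prodExp (bitWeight B q) (fun ω => Real.exp (t * zeroCount A R ω))
      ≤ Real.exp (t * ∑ u ∈ A, (1 - q) ^ #(R u) + q * (t * k) ^ 2 * (#A * M)) := by
  refine (prodExp_exp_le_of_bounded_differences h0 h1 ht (A.biUnion R)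
    (f := fun ω => t * zeroCount A R ω) (fun x y hxy => ?_) fun b _ ω => ?_).trans ?_
  · exact congrArg (fun n : ℕ => t * (n : ℝ)) 
      (dependsOn_zeroCount A R fun b ⟨u, hu, hb⟩ => hxy b (by
        simp only [coe_biUnion, Set.mem_iUnion]; exact ⟨u, hu, hb⟩))
  · rw [← mul_sub, abs_mul]
    exact mul_le_mul_of_nonneg_left (abs_zeroCount_update_sub_le A R b (hk b) ω) (abs_nonneg t)
  · rw [prodExp_const_mul, prodExp_zeroCount, Real.exp_le_exp, mul_pow, mul_pow, sq_abs]
    gcongr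
    exact_mod_cast card_biUnion_le_card_mul A R M hM

/-- Upper tail of `zeroCount`. -/
lemma prodProb_le_zeroCount (h0 : 0 ≤ q) (h1 : q ≤ 1) {U : Type*} (A : Finset U)
    (R : U → Finset B) {k M : ℕ} (hk : ∀ b, #{u ∈ A | b ∈ R u} ≤ k) (hM : ∀ u ∈ A, #(R u) ≤ M)
    {t x : ℝ} (ht0 : 0 ≤ t) (ht : t * k ≤ 1) :
    prodProb (bitWeight B q) (fun ω => ∑ u ∈ A, (1 - q) ^ #(R u) + x ≤ zeroCount A R ω)
      ≤ Real.exp (-(t * x) + q * (t * k) ^ 2 * (#A * M)) := by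
  have hw := isWeight_bitWeight B h0 h1
  refine (prodProb_mono hw fun ω hω => mul_le_mul_of_nonneg_left hω ht0).trans
    ((prodProb_le_exp_mul hw _ _).trans ?_)
  refine (mul_le_mul_of_nonneg_left (prodExp_exp_zeroCount_le h0 h1 A R hk hM
    (by rwa [abs_of_nonneg ht0])) (Real.exp_pos _).le).trans_eq ?_
  rw [← Real.exp_add]
  congr 1
  ring

/-- Lower tail of `zeroCount`. -/
lemma prodProb_zeroCount_le (h0 : 0 ≤ q) (h1 : q ≤ 1) {U : Type*} (A : Finset U)
    (R : U → Finset B) {k M : ℕ} (hk : ∀ b, #{u ∈ A | b ∈ R u} ≤ k) (hM : ∀ u ∈ A, #(R u) ≤ M)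
    {t x : ℝ} (ht0 : 0 ≤ t) (ht : t * k ≤ 1) :
    prodProb (bitWeight B q) (fun ω => (zeroCount A R ω : ℝ) ≤ ∑ u ∈ A, (1 - q) ^ #(R u) - x)
      ≤ Real.exp (-(t * x) + q * (t * k) ^ 2 * (#A * M)) := by
  have hw := isWeight_bitWeight B h0 h1
  refine (prodProb_mono hw fun ω hω =>
    mul_le_mul_of_nonpos_left hω (neg_nonpos.2 ht0)).trans
    ((prodProb_le_exp_mul hw _ _).trans ?_)
  refine (mul_le_mul_of_nonneg_left (prodExp_exp_zeroCount_le h0 h1 A R hk hM (t := -t)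
    (by rwa [abs_neg, abs_of_nonneg ht0])) (Real.exp_pos _).le).trans_eq ?_
  rw [← Real.exp_add]
  congr 1
  ring

/-- The expectation of the exponential number of `true` bits in `S`, on the event that the
distinct bits `b₁` and `b₂` are both `true`. -/
lemma prodExp_pair_mul_exp_count_le (h0 : 0 ≤ q) (h1 : q ≤ 1) (S : Finset B) {b₁ b₂ : B}
    (hb : b₁ ≠ b₂) :
    prodExp (bitWeight B q) (fun ω => if ω b₁ ∧ ω b₂ then Real.exp #{b ∈ S | ω b} else 0)
      ≤ q ^ 2 * Real.exp (2 + 2 * q * #S) := by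
  have h := prodExp_prod (w := bitWeight B q) (fun b k =>
    (if b = b₁ ∨ b = b₂ then (if k then (1 : ℝ) else 0) else 1)
      * if b ∈ S then (if k then Real.exp 1 else 1) else 1)
  have he : Real.exp 1 ≤ 3 := Real.exp_one_lt_three.le
  have he1 : 1 ≤ Real.exp 1 := Real.one_le_exp zero_le_one
  have hfac : (fun ω : B → Bool => if ω b₁ ∧ ω b₂ then Real.exp #{b ∈ S | ω b} else 0)
      = fun ω => ∏ b, ((if b = b₁ ∨ b = b₂ then (if ω b then (1 : ℝ) else 0) else 1)
        * if b ∈ S then (if ω b then Real.exp 1 else 1) else 1) := by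
    funext ω
    rw [prod_mul_distrib]
    have e1 : ∏ b, (if b ∈ S then (if ω b then Real.exp 1 else 1) else 1)
        = Real.exp #{b ∈ S | ω b} := by
      rw [prod_ite_mem, univ_inter, ← prod_filter, prod_const, ← Real.exp_nat_mul, mul_one]
    rw [e1]
    split_ifs with hω
    · rw [prod_eq_one, one_mul]
      intro b _
      split_ifs with hb1 hb2
      · rfl
      · rcases hb1 with rfl | rfl
        · exact absurd hω.1 hb2
        · exact absurd hω.2 hb2
      · rfl
    · rw [not_and_or] at hω
      rcases hω with hω | hω
      · rw [prod_eq_zero (mem_univ b₁) (by simp [hω]), zero_mul]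
      · rw [prod_eq_zero (mem_univ b₂) (by simp [hω]), zero_mul]
  rw [hfac, h]
  have hq2 : 1 + 2 * q ≤ Real.exp (2 * q) := by linarith [Real.add_one_le_exp (2 * q)]
  have hge : 1 ≤ Real.exp (2 * q) := by linarith
  -- A bit of `S` contributes `1 + q * (e - 1) ≤ exp (2 * q)`; each of the two forced bits
  -- contributes at most `q * e`, whether or not it lies in `S`.
  calc _ ≤ ∏ b, ((if b = b₁ then q * Real.exp 1 else 1) * (if b = b₂ then q * Real.exp 1 else 1)
          * if b ∈ S then Real.exp (2 * q) else 1) := by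
        refine prod_le_prod (fun b _ => sum_nonneg fun k _ => mul_nonneg
          ((isWeight_bitWeight B h0 h1).nonneg b k) ?_) fun b _ => ?_
        · split_ifs <;> positivity
        · have hqe : 0 ≤ q * Real.exp 1 := by positivity
          by_cases c1 : b = b₁
          · subst c1
            by_cases c3 : b ∈ S
            · simp [bitWeight, hb, c3]; nlinarith
            · simp [bitWeight, hb, c3]; nlinarith
          · by_cases c2 : b = b₂
            · subst c2
              by_cases c3 : b ∈ S
              · simp [bitWeight, c1, c3]; nlinarith
              · simp [bitWeight, c1, c3]; nlinarith
            · by_cases c3 : b ∈ S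
              · simp [bitWeight, c1, c2, c3]; nlinarith
              · simp [bitWeight, c1, c2, c3]
    _ = _ := by
        rw [prod_mul_distrib, prod_mul_distrib, prod_ite_mem, univ_inter, prod_const,
          prod_ite_eq' univ b₁, prod_ite_eq' univ b₂, if_pos (mem_univ _), if_pos (mem_univ _),
          ← Real.exp_nat_mul, show (2 : ℝ) + 2 * q * #S = 1 + 1 + #S * (2 * q) by ring,
          Real.exp_add, Real.exp_add]
        ring

end Bits

/-! ### Nearly disjoint systems and the sparse case -/

/-- A family of graphs, given by their vertex sets `mem i` and adjacency relations `adj i`, any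
two of which share at most one vertex, and such that each vertex lies in at most `N` of them. -/
structure NearlyDisjointSystem (V ι : Type*) [Fintype ι] (N : ℕ) where
  mem : ι → V → Prop
  adj : ι → V → V → Prop
  symm : ∀ {i u v}, adj i u v → adj i v u
  irrefl : ∀ i v, ¬ adj i v v
  mem_left : ∀ {i u v}, adj i u v → mem i u
  eq_of_mem : ∀ {i j u v}, i ≠ j → mem i u → mem j u → mem i v → mem j v → u = v
  card_mem_le : ∀ v, #{i | mem i v} ≤ N

namespace NearlyDisjointSystem

variable {V ι α : Type*} [Fintype V] [Fintype ι] {N : ℕ}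

/-- The neighbours of `v` in the `i`-th graph whose list contains `c`. -/
noncomputable def nbrs (G : NearlyDisjointSystem V ι N) (L : V → Finset α) (i : ι) (v : V)
    (c : α) : Finset V :=
  {u | G.adj i v u ∧ c ∈ L u}

/-- The neighbours of `v` in the union whose list contains `c`. -/
noncomputable def allNbrs (G : NearlyDisjointSystem V ι N) (L : V → Finset α) (v : V)
    (c : α) : Finset V :=
  {u | (∃ i, G.adj i v u) ∧ c ∈ L u}

/-- The nonempty lists have size `ℓ`, and the color degrees are at most `d`. -/
structure IsBounded (G : NearlyDisjointSystem V ι N) (L : V → Finset α) (d ℓ : ℕ) : Prop where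
  card_list : ∀ v, L v = ∅ ∨ #(L v) = ℓ
  card_nbrs_le : ∀ i v, ∀ c ∈ L v, #(G.nbrs L i v c) ≤ d

/-- The vertices with nonempty lists have a proper coloring from their lists. -/
def Colorable (G : NearlyDisjointSystem V ι N) (L : V → Finset α) : Prop :=
  ∃ φ : V → α, (∀ v, L v ≠ ∅ → φ v ∈ L v) ∧
    ∀ i u v, G.adj i u v → L u ≠ ∅ → L v ≠ ∅ → φ u ≠ φ v

variable {G : NearlyDisjointSystem V ι N} {L : V → Finset α} {d ℓ : ℕ}

lemma IsBounded.card_list_eq (h : G.IsBounded L d ℓ) {v : V} {c : α} (hc : c ∈ L v) :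
    #(L v) = ℓ :=
  (h.card_list v).resolve_left (ne_empty_of_mem hc)

lemma IsBounded.card_list_le (h : G.IsBounded L d ℓ) (v : V) : #(L v) ≤ ℓ := by
  rcases h.card_list v with h | h <;> simp [h]

lemma IsBounded.card_allNbrs_le (h : G.IsBounded L d ℓ) {v : V} {c : α} (hc : c ∈ L v) :
    #(G.allNbrs L v c) ≤ N * d := by
  have hsub : G.allNbrs L v c ⊆ ({i | G.mem i v} : Finset ι).biUnion fun i => G.nbrs L i v c := by
    intro u hu
    obtain ⟨⟨i, hi⟩, hc⟩ := (mem_filter.1 hu).2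
    exact mem_biUnion.2 ⟨i, by simp [G.mem_left hi], by simp [nbrs, hi, hc]⟩
  refine (card_le_card hsub).trans ((card_biUnion_le_card_mul _ _ d fun i _ =>
    h.card_nbrs_le i v c hc).trans (Nat.mul_le_mul_right d (G.card_mem_le v)))

/-- If the lists are much larger than the color degrees, then the local lemma gives a coloring. -/
theorem IsBounded.colorable_of_sparse [Fintype α] [Nonempty α] (h : G.IsBounded L d ℓ)
    (hℓ : 3 ≤ ℓ) (hd : 32 * (N * d) ≤ ℓ) : G.Colorable L := by
  let c₀ : α := Classical.arbitrary α
  -- A vertex with empty list still needs a probability distribution, so it receives the dummy color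
  -- `c₀`; it takes part in no bad event.
  let L₀ : V → Finset α := fun v => if L v = ∅ then {c₀} else L v
  have hL₀ : ∀ v, 0 < #(L₀ v) := fun v => by
    by_cases hv : L v = ∅
    · simp [L₀, hv]
    · simp [L₀, hv, card_pos, nonempty_iff_ne_empty]
  let w : V → α → ℝ := fun v c => if c ∈ L₀ v then (#(L₀ v) : ℝ)⁻¹ else 0
  have hw : IsWeight w :=
    { nonneg := fun v c => by dsimp only [w]; split_ifs <;> positivity
      sum_eq_one := fun v => by
        have : (#(L₀ v) : ℝ) ≠ 0 := by exact_mod_cast (hL₀ v).ne'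
        simp [w, this] }
  have hwL : ∀ v c, c ∈ L v → w v c = (ℓ : ℝ)⁻¹ := fun v c hc => by
    simp [w, L₀, ne_empty_of_mem hc, hc, h.card_list_eq hc]
  -- One bad event per ordered adjacent pair and common color. Hence the factor 4 below: the event
  -- shares either endpoint of `x`, in either position.
  let I := {x : V × V × α // (∃ i, G.adj i x.1 x.2.1) ∧ x.2.2 ∈ L x.1 ∧ x.2.2 ∈ L x.2.1}
  let A : I → (V → α) → Prop := fun x ω => ω x.1.1 = x.1.2.2 ∧ ω x.1.2.1 = x.1.2.2
  let s : I → Finset V := fun x => {x.1.1, x.1.2.1}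
  have hA : ∀ x, DependsOn (A x) (s x : Set V) := by
    intro x ω ω' hω
    simp only [A]
    rw [hω x.1.1 (by simp [s]), hω x.1.2.1 (by simp [s])]
  have hπ : ∀ x, prodProb w (A x) ≤ ((ℓ : ℝ) ^ 2)⁻¹ := by
    rintro ⟨⟨u, v, c⟩, ⟨i, hi⟩, hcu, hcv⟩
    have huv : u ≠ v := by rintro rfl; exact G.irrefl i u hi
    have e : prodProb w (A ⟨⟨u, v, c⟩, ⟨i, hi⟩, hcu, hcv⟩)
        = prodExp w (fun ω => (if ω u = c then 1 else 0) * (if ω v = c then 1 else 0)) := by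
      rw [prodProb]
      congr 1
      funext ω
      by_cases h1 : ω u = c <;> by_cases h2 : ω v = c <;> simp [A, h1, h2]
    have single : ∀ y, c ∈ L y →
        prodExp w (fun ω => if ω y = c then (1 : ℝ) else 0) = (ℓ : ℝ)⁻¹ := by
      intro y hy
      have h1 := prodExp_prod (w := w) (fun b k => if b = y then (if k = c then (1 : ℝ) else 0) else 1)
      have h2 : ∀ b, ∑ k, w b k * (if b = y then (if k = c then (1 : ℝ) else 0) else 1)
          = if b = y then (ℓ : ℝ)⁻¹ else 1 := by
        intro b
        by_cases hb : b = y
        · subst hb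
          simp [hwL b c hy]
        · simp [hb, hw.sum_eq_one]
      simpa only [h2, prod_ite_eq', mem_univ, if_true] using h1
    rw [e, prodExp_mul_of_dependsOn hw (s := {u}) (t := {v}) (by simpa using huv), single u hcu,
      single v hcv, ← mul_inv, sq]
    · intro x y hxy
      simp [hxy u (by simp)]
    · intro x y hxy
      simp [hxy v (by simp)]
  have hΔ : ∀ x : I, #{y | ¬ Disjoint (s x) (s y)} ≤ 4 * (ℓ * (N * d)) := by
    intro x
    let F : V → Finset (V × V × α) := fun u =>
      (L u).biUnion fun c => (G.allNbrs L u c).image fun v => (u, v, c)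
    let F' : V → Finset (V × V × α) := fun u =>
      (L u).biUnion fun c => (G.allNbrs L u c).image fun v => (v, u, c)
    have hF : ∀ u, #(F u) ≤ ℓ * (N * d) := fun u =>
      (card_biUnion_le_card_mul _ _ _ fun c hc => card_image_le.trans (h.card_allNbrs_le hc)).trans
        (Nat.mul_le_mul_right _ (h.card_list_le u))
    have hF' : ∀ u, #(F' u) ≤ ℓ * (N * d) := fun u =>
      (card_biUnion_le_card_mul _ _ _ fun c hc => card_image_le.trans (h.card_allNbrs_le hc)).trans
        (Nat.mul_le_mul_right _ (h.card_list_le u))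
    have hsub : (univ.filter fun y => ¬ Disjoint (s x) (s y)).image Subtype.val
        ⊆ (F x.1.1 ∪ F' x.1.1) ∪ (F x.1.2.1 ∪ F' x.1.2.1) := by
      intro z hz
      obtain ⟨⟨⟨u, v, c⟩, ⟨i, hi⟩, hcu, hcv⟩, hy, rfl⟩ := mem_image.1 hz
      have hFu : (u, v, c) ∈ F u := mem_biUnion.2 ⟨c, hcu, mem_image.2
        ⟨v, by simp only [allNbrs, mem_filter, mem_univ, true_and]; exact ⟨⟨i, hi⟩, hcv⟩, rfl⟩⟩
      have hFv : (u, v, c) ∈ F' v := mem_biUnion.2 ⟨c, hcv, mem_image.2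
        ⟨u, by simp only [allNbrs, mem_filter, mem_univ, true_and]
               exact ⟨⟨i, G.symm hi⟩, hcu⟩, rfl⟩⟩
      obtain ⟨y, hy1, hy2⟩ := not_disjoint_iff.1 (mem_filter.1 hy).2
      simp only [s, mem_insert, mem_singleton] at hy1 hy2
      simp only [mem_union]
      rcases hy2 with rfl | rfl <;> rcases hy1 with h1 | h1 <;> rw [← h1] <;> tauto
    rw [← card_image_of_injective _ Subtype.val_injective]
    refine (card_le_card hsub).trans ?_
    have h1 := card_union_le (F x.1.1 ∪ F' x.1.1) (F x.1.2.1 ∪ F' x.1.2.1)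
    have h2 := card_union_le (F x.1.1) (F' x.1.1)
    have h3 := card_union_le (F x.1.2.1) (F' x.1.2.1)
    have h4 := hF x.1.1
    have h5 := hF x.1.2.1
    have h6 := hF' x.1.1
    have h7 := hF' x.1.2.1
    omega
  have hℓ' : (3 : ℝ) ≤ ℓ := by exact_mod_cast hℓ
  have hd' : (32 : ℝ) * (N * d) ≤ ℓ := by exact_mod_cast hd
  -- With `Δ = 4 * ℓ * N * d + 1` the condition reads `16 * ℓ * N * d + 4 ≤ ℓ ^ 2`; the constant 32
  -- makes the first term at most `ℓ ^ 2 / 2`, and `ℓ ≥ 3` absorbs the 4.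
  obtain ⟨ω, hω, hωA⟩ := exists_forall_not_of_localLemma hw A s hA _ _ hπ
    (fun x => (hΔ x).trans (Nat.le_succ _)) (Nat.le_add_left 1 _) (by
      push_cast
      rw [mul_right_comm, ← div_eq_mul_inv, div_le_one (by positivity)]
      nlinarith)
  have hmem : ∀ v, L v ≠ ∅ → ω v ∈ L v := fun v hv => by
    have := hω v
    by_contra hc
    simp [w, L₀, hv, hc] at this
  refine ⟨ω, hmem, fun i u v huv hu hv heq => ?_⟩
  exact hωA ⟨⟨u, v, ω u⟩, ⟨i, huv⟩, hmem u hu, heq ▸ hmem v hv⟩ ⟨rfl, heq.symm⟩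

end NearlyDisjointSystem

namespace NearlyDisjointSystem

variable {V ι α : Type*} [Fintype V] [Fintype ι] {N : ℕ}

/-! ### The random bits of a nibble step -/

/-- The bit `select u x` says whether `u` selects the color `x`; the bits `pad u x t` are
used to equalize the probabilities that a color survives. -/
inductive Bit (V α : Type*) (n : ℕ) : Type _
  | select (u : V) (x : α) : Bit V α n
  | pad (u : V) (x : α) (t : Fin n) : Bit V α n

noncomputable instance {V α : Type*} [Fintype V] [Fintype α] {n : ℕ} : Fintype (Bit V α n) :=
  Fintype.ofSurjective (fun y : (V × α) ⊕ (V × α × Fin n) =>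
    Sum.elim (fun z => Bit.select z.1 z.2) (fun z => Bit.pad z.1 z.2.1 z.2.2) y) fun b => by
      cases b with
      | select u x => exact ⟨.inl (u, x), rfl⟩
      | pad u x t => exact ⟨.inr (u, x, t), rfl⟩

/-- The vertex to which a bit belongs. -/
def Bit.owner {V α : Type*} {n : ℕ} : Bit V α n → V
  | .select u _ => u
  | .pad u _ _ => u

/-- The color to which a bit belongs. -/
def Bit.color {V α : Type*} {n : ℕ} : Bit V α n → α
  | .select _ x => x
  | .pad _ x _ => x

/-- The bits that must be `false` for the color `x` to survive at `u`. -/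
noncomputable def conflictBits (G : NearlyDisjointSystem V ι N) (L : V → Finset α) (n : ℕ)
    (u : V) (x : α) : Finset (Bit V α n) :=
  (G.allNbrs L u x).image (fun w => .select w x) ∪
    ({t | t.val < n - #(G.allNbrs L u x)} : Finset (Fin n)).image (fun t => .pad u x t)

/-- The bits that are all `false` if `u` selects no color and `c` survives at `u` with respect
to all graphs but the `i`-th. -/
noncomputable def outerBits (G : NearlyDisjointSystem V ι N) (L : V → Finset α) (n : ℕ) (i : ι)
    (c : α) (u : V) : Finset (Bit V α n) :=
  (G.conflictBits L n u c \ (G.nbrs L i u c).image fun w => .select w c) ∪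
    (L u).image fun x => .select u x

variable {G : NearlyDisjointSystem V ι N} {L : V → Finset α} {d ℓ n : ℕ}

lemma mem_nbrs {i : ι} {v u : V} {c : α} : u ∈ G.nbrs L i v c ↔ G.adj i v u ∧ c ∈ L u := by
  simp [nbrs]

lemma mem_allNbrs {v u : V} {c : α} :
    u ∈ G.allNbrs L v c ↔ (∃ i, G.adj i v u) ∧ c ∈ L u := by
  simp [allNbrs]

lemma select_mem_conflictBits {u w : V} {x y : α} :
    (.select w y : Bit V α n) ∈ G.conflictBits L n u x ↔ w ∈ G.allNbrs L u x ∧ y = x := by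
  simp [conflictBits, eq_comm]

lemma color_of_mem_conflictBits {u : V} {x : α} {b : Bit V α n}
    (hb : b ∈ G.conflictBits L n u x) : b.color = x := by
  rcases mem_union.1 hb with h | h <;> obtain ⟨_, _, rfl⟩ := mem_image.1 h <;> rfl

/-- The `pad` bits make up the difference to `N * d`, so the survival probability does not depend on
the actual color degree. Without them a color could survive too often for the degree estimate. -/
lemma IsBounded.card_conflictBits (h : G.IsBounded L d ℓ) {u : V} {x : α} (hx : x ∈ L u) :
    #(G.conflictBits L (N * d) u x) = N * d := by
  have hle := h.card_allNbrs_le hx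
  rw [conflictBits, card_union_of_disjoint, card_image_of_injective, card_image_of_injective,
    Fin.card_filter_val_lt]
  · omega
  · intro s t hst
    simpa using hst
  · intro s t hst
    simpa using hst
  · rw [disjoint_left]
    intro b hb hb'
    obtain ⟨_, _, rfl⟩ := mem_image.1 hb
    simp at hb'

/-- Discarding graph `i` removes at most `d` conflict bits, and the `ℓ` selection bits of `u` are
new because `u` is not its own neighbour. -/
lemma IsBounded.le_card_outerBits (h : G.IsBounded L d ℓ) {i : ι} {u : V} {c : α}
    (hc : c ∈ L u) : N * d - d + ℓ ≤ #(G.outerBits L (N * d) i c u) := by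
  rw [outerBits, card_union_of_disjoint, card_image_of_injective (L u), h.card_list_eq hc]
  · have h1 := le_card_sdiff ((G.nbrs L i u c).image fun w => (.select w c : Bit V α (N * d)))
      (G.conflictBits L (N * d) u c)
    have h2 : #((G.nbrs L i u c).image fun w => (.select w c : Bit V α (N * d))) ≤ d :=
      card_image_le.trans (h.card_nbrs_le i u c hc)
    rw [h.card_conflictBits hc] at h1
    omega
  · intro s t hst
    simpa using hst
  · rw [disjoint_left]
    intro b hb hb'
    obtain ⟨x, _, rfl⟩ := mem_image.1 hb'
    obtain ⟨⟨i, hi⟩, _⟩ := mem_allNbrs.1 (select_mem_conflictBits.1 (mem_sdiff.1 hb).1).1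
    exact G.irrefl i u hi

lemma IsBounded.card_outerBits_le (h : G.IsBounded L d ℓ) {i : ι} {u : V} {c : α}
    (hc : c ∈ L u) : #(G.outerBits L (N * d) i c u) ≤ N * d + ℓ := by
  refine (card_union_le _ _).trans (add_le_add ?_ (card_image_le.trans (h.card_list_le u)))
  exact (card_le_card sdiff_subset).trans (h.card_conflictBits hc).le

/-- Near disjointness bounds the influence of each bit. -/
lemma card_mem_outerBits_le {i : ι} {v : V} {c : α} (hN : 1 ≤ N) (b : Bit V α n) :
    #{u ∈ G.nbrs L i v c | b ∈ G.outerBits L n i c u} ≤ N := by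
  rcases b with ⟨w, y⟩ | ⟨w, y, t⟩
  · have hex : ∀ u ∈ (G.nbrs L i v c).filter fun u => .select w y ∈ G.outerBits L n i c u,
        ∃ j, G.mem j w ∧ G.mem j u ∧ G.mem i u ∧ (j = i → u = w) := by
      intro u hu
      obtain ⟨hu, hb⟩ := mem_filter.1 hu
      have hiu : G.mem i u := G.mem_left (G.symm (mem_nbrs.1 hu).1)
      rcases mem_union.1 hb with hb | hb
      · obtain ⟨hb1, hb2⟩ := mem_sdiff.1 hb
        obtain ⟨hw, rfl⟩ := select_mem_conflictBits.1 hb1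
        obtain ⟨⟨j, hj⟩, hcw⟩ := mem_allNbrs.1 hw
        refine ⟨j, G.mem_left (G.symm hj), G.mem_left hj, hiu, ?_⟩
        rintro rfl
        exact absurd (mem_image.2 ⟨w, mem_nbrs.2 ⟨hj, hcw⟩, rfl⟩) hb2
      · obtain ⟨x, _, hx⟩ := mem_image.1 hb
        obtain rfl : u = w := congrArg Bit.owner hx
        exact ⟨i, hiu, hiu, hiu, fun _ => rfl⟩
    have : Nonempty ι := ⟨i⟩
    choose! f hf using hex
    refine (card_le_card_of_injOn f (t := {j | G.mem j w}) (fun u hu => ?_)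
      fun u hu u' hu' heq => ?_).trans (G.card_mem_le w)
    · simpa using (hf u hu).1
    · obtain ⟨-, h2, h3, h4⟩ := hf u hu
      obtain ⟨-, h2', h3', h4'⟩ := hf u' hu'
      by_cases hi : f u = i
      · rw [h4 hi, h4' (heq ▸ hi)]
      · exact G.eq_of_mem hi h2 h3 (heq ▸ h2') h3'
  · refine le_trans (card_le_one.2 fun u hu u' hu' => ?_) hN
    have hw : ∀ u ∈ (G.nbrs L i v c).filter fun u => .pad w y t ∈ G.outerBits L n i c u,
        u = w := by
      intro u hu
      have hb := (mem_filter.1 hu).2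
      simp only [outerBits, conflictBits, mem_union, mem_sdiff, mem_image, reduceCtorEq, and_false,
        exists_false, false_or, or_false] at hb
      obtain ⟨⟨s, _, hs⟩, _⟩ := hb
      exact congrArg Bit.owner hs
    rw [hw u hu, hw u' hu']

lemma card_mem_conflictBits_le {v : V} (b : Bit V α n) :
    #{c ∈ L v | b ∈ G.conflictBits L n v c} ≤ 1 :=
  card_le_one.2 fun c hc c' hc' => by
    rw [← color_of_mem_conflictBits (mem_filter.1 hc).2,
      color_of_mem_conflictBits (mem_filter.1 hc').2]

/-- The neighbours of `v` in the `i`-th graph having `c` in their lists which select the color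
`x` and for which `x` does not survive. -/
noncomputable def spoiledSet (G : NearlyDisjointSystem V ι N) (L : V → Finset α) (n : ℕ) (i : ι)
    (v : V) (c x : α) (ω : Bit V α n → Bool) : Finset V :=
  {u ∈ G.nbrs L i v c | x ∈ L u ∧ ω (.select u x) ∧ ∃ b ∈ G.conflictBits L n u x, ω b}

lemma mem_spoiledSet {i : ι} {u v : V} {c x : α} {ω : Bit V α n → Bool} :
    u ∈ G.spoiledSet L n i v c x ω ↔ u ∈ G.nbrs L i v c ∧
      x ∈ L u ∧ ω (.select u x) ∧ ∃ b ∈ G.conflictBits L n u x, ω b :=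
  mem_filter

/-- The number of spoiled neighbours. -/
noncomputable def spoiled (G : NearlyDisjointSystem V ι N) (L : V → Finset α) (n : ℕ) (i : ι)
    (v : V) (c x : α) (ω : Bit V α n → Bool) : ℕ :=
  #(G.spoiledSet L n i v c x ω)

/-- Spoiling for distinct colors involves disjoint sets of bits, so the exponential moment of the
total factors over colors. -/
lemma dependsOn_spoiled [Fintype α] (i : ι) (v : V) (c x : α) :
    DependsOn (G.spoiled L n i v c x)
      (({b | b.color = x} : Finset (Bit V α n)) : Set (Bit V α n)) := by
  intro ω ω' h
  simp only [coe_filter, mem_univ, true_and, Set.mem_ofPred_eq] at h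
  refine congrArg card (filter_congr fun u _ => ?_)
  rw [h (.select u x) rfl]
  refine and_congr Iff.rfl (and_congr Iff.rfl (exists_congr fun b => ?_))
  refine and_congr_right fun hb => ?_
  rw [h b (color_of_mem_conflictBits hb)]

/-- Bounded differences are unavailable, as one bit in graph `i` can spoil many neighbours. Instead,
a nonzero count forces two distinct true bits, a selection and a conflict, which costs `q ^ 2` for
each of the `N * d` conflict bits of each candidate `u`. The constant 21 bounds `exp 3`. -/
lemma IsBounded.prodExp_exp_spoiled_le [Fintype α] (h : G.IsBounded L d ℓ) {q : ℝ} (h0 : 0 ≤ q)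
    (h1 : q ≤ 1) (hqd : 2 * q * d ≤ 1) {i : ι} {v : V} {c : α} (hc : c ∈ L v) (x : α) :
    prodExp (bitWeight (Bit V α (N * d)) q)
        (fun ω => Real.exp (G.spoiled L (N * d) i v c x ω))
      ≤ Real.exp (21 * q ^ 2 * (N * d) * #{u ∈ G.nbrs L i v c | x ∈ L u}) := by
  have hw := isWeight_bitWeight (Bit V α (N * d)) h0 h1
  set A := (G.nbrs L i v c).filter fun u => x ∈ L u with hA
  let S : Finset (Bit V α (N * d)) := A.image fun u => .select u x
  have hS : (#S : ℝ) ≤ d := by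
    exact_mod_cast card_image_le.trans ((card_le_card (filter_subset _ _)).trans
      (h.card_nbrs_le i v c hc))
  have he : Real.exp (2 + 2 * q * #S) ≤ 21 := by
    have h3 : 2 + 2 * q * #S ≤ 3 := by nlinarith
    refine (Real.exp_le_exp.2 h3).trans ?_
    have : Real.exp 3 = Real.exp 1 ^ 3 := by rw [← Real.exp_nat_mul]; norm_num
    rw [this]
    have h27 := Real.exp_one_lt_d9.le
    calc Real.exp 1 ^ 3 ≤ 2.7182818286 ^ 3 := by gcongr
      _ ≤ 21 := by norm_num
  calc _ ≤ prodExp (bitWeight (Bit V α (N * d)) q) (fun ω => 1 + ∑ u ∈ A,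
          ∑ b ∈ G.conflictBits L (N * d) u x,
            if ω (.select u x) ∧ ω b then Real.exp #{b ∈ S | ω b} else 0) := by
        refine prodExp_mono hw fun ω => ?_
        have hnn : ∀ u ∈ A, 0 ≤ ∑ b ∈ G.conflictBits L (N * d) u x,
            if ω (.select u x) ∧ ω b then Real.exp #{b ∈ S | ω b} else 0 := fun u _ =>
          sum_nonneg fun b _ => by split_ifs <;> positivity
        rcases Nat.eq_zero_or_pos (G.spoiled L (N * d) i v c x ω) with hz | hpos
        · rw [hz]
          simpa using sum_nonneg hnn
        · obtain ⟨u, hu⟩ := card_pos.1 hpos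
          obtain ⟨hu, hxu, hsel, b, hb, hωb⟩ := mem_spoiledSet.1 hu
          have hle : G.spoiled L (N * d) i v c x ω ≤ #{b ∈ S | ω b} := by
            refine card_le_card_of_injOn (fun u => .select u x) (fun u hu => ?_) fun u _ u' _ => ?_
            · obtain ⟨hu, hxu, hsel, -⟩ := mem_spoiledSet.1 hu
              exact mem_filter.2 ⟨mem_image_of_mem _ (mem_filter.2 ⟨hu, hxu⟩), hsel⟩
            · simp
          have e1 := single_le_sum hnn (mem_filter.2 ⟨hu, hxu⟩ : u ∈ A)
          have e2 := single_le_sum (f := fun b => if ω (.select u x) ∧ ω b then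
            Real.exp #{b ∈ S | ω b} else 0) (fun b _ => by split_ifs <;> positivity) hb
          simp only [hsel, hωb, and_self, if_true] at e1 e2
          have e3 : Real.exp (G.spoiled L (N * d) i v c x ω) ≤ Real.exp #{b ∈ S | ω b} :=
            Real.exp_le_exp.2 (by exact_mod_cast hle)
          linarith
    _ ≤ 1 + ∑ u ∈ A, (N * d : ℕ) * (q ^ 2 * 21) := by
        rw [prodExp_add, prodExp_const hw, prodExp_sum]
        refine add_le_add le_rfl (sum_le_sum fun u hu => ?_)
        have hxu := (mem_filter.1 hu).2
        rw [prodExp_sum, ← nsmul_eq_mul]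
        refine (sum_le_card_nsmul _ _ (q ^ 2 * 21) fun b hb => ?_).trans_eq
          (by rw [h.card_conflictBits hxu])
        refine (prodExp_pair_mul_exp_count_le h0 h1 S ?_).trans
          (mul_le_mul_of_nonneg_left he (sq_nonneg q))
        rintro rfl
        obtain ⟨⟨i, hi⟩, _⟩ := mem_allNbrs.1 (select_mem_conflictBits.1 hb).1
        exact G.irrefl i u hi
    _ ≤ _ := by
        rw [sum_const, nsmul_eq_mul]
        refine le_trans (le_of_eq ?_) (Real.add_one_le_exp _)
        push_cast
        ring

/-- The neighbours of `v` that are spoiled are few. -/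
lemma IsBounded.prodProb_le_sum_spoiled [Fintype α] (h : G.IsBounded L d ℓ) {q : ℝ} (h0 : 0 ≤ q)
    (h1 : q ≤ 1) (hqd : 2 * q * d ≤ 1) {i : ι} {v : V} {c : α} (hc : c ∈ L v) (a : ℝ) :
    prodProb (bitWeight (Bit V α (N * d)) q)
        (fun ω => a ≤ ∑ x, (G.spoiled L (N * d) i v c x ω : ℝ))
      ≤ Real.exp (-a + 21 * q ^ 2 * (N * d) * (d * ℓ)) := by
  have hw := isWeight_bitWeight (Bit V α (N * d)) h0 h1
  refine (prodProb_le_exp_mul hw _ a).trans ?_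
  rw [Real.exp_add]
  refine mul_le_mul_of_nonneg_left ?_ (Real.exp_pos _).le
  simp only [Real.exp_sum]
  rw [prodExp_prod_of_dependsOn hw univ (fun x : α => {b | b.color = x})]
  · refine (prod_le_prod (fun x _ => prodExp_nonneg hw fun ω => (Real.exp_pos _).le)
      fun x _ => h.prodExp_exp_spoiled_le h0 h1 hqd hc x).trans ?_
    rw [← Real.exp_sum, Real.exp_le_exp, ← mul_sum]
    refine mul_le_mul_of_nonneg_left ?_ (by positivity)
    -- Double counting of the pairs `(u, x)` with `x ∈ L u`.
    have : ∑ x : α, #{u ∈ G.nbrs L i v c | x ∈ L u} = ∑ u ∈ G.nbrs L i v c, #(L u) := by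
      simp only [card_filter]
      rw [sum_comm]
      simp
    have hle : ∑ x : α, #{u ∈ G.nbrs L i v c | x ∈ L u} ≤ d * ℓ := by
      rw [this]
      refine (sum_le_card_nsmul _ _ _ fun u _ => h.card_list_le u).trans ?_
      rw [smul_eq_mul]
      exact Nat.mul_le_mul_right _ (h.card_nbrs_le i v c hc)
    exact_mod_cast hle
  · intro x _ y _ hxy
    rw [Function.onFun, disjoint_left]
    intro b hb hb'
    exact hxy ((mem_filter.1 hb).2.symm.trans (mem_filter.1 hb').2)
  · intro x _ ω ω' hω
    exact congrArg (fun m : ℕ => Real.exp m) (dependsOn_spoiled i v c x hω)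

end NearlyDisjointSystem

namespace NearlyDisjointSystem

variable {V ι α : Type*} [Fintype V] [Fintype ι] {N : ℕ}

/-! ### One nibble step -/

/-- The lower bound for the list sizes after a nibble step. -/
noncomputable def nextList (N d ℓ : ℕ) (p : ℝ) : ℝ :=
  ℓ * (1 - p / ℓ) ^ (N * d) - p ^ 2 * d

/-- The upper bound for the color degrees after a nibble step. -/
noncomputable def nextDegree (N d ℓ : ℕ) (p : ℝ) : ℝ :=
  d * (1 - p / ℓ) ^ (N * d - d + ℓ) + p ^ 2 * d + 42 * N * p ^ 2 * d

/-- The event that too few colors survive at `v`. -/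
def ListBad (G : NearlyDisjointSystem V ι N) (L : V → Finset α) (d ℓ : ℕ) (p : ℝ) (v : V)
    (ω : Bit V α (N * d) → Bool) : Prop :=
  L v ≠ ∅ ∧ (zeroCount (L v) (G.conflictBits L (N * d) v) ω : ℝ) ≤ nextList N d ℓ p

/-- The event that too many neighbours of `v` in the `i`-th graph select no color and keep `c` as
far as the other graphs are concerned. -/
def OuterBad (G : NearlyDisjointSystem V ι N) (L : V → Finset α) (d ℓ : ℕ) (p : ℝ) (v : V)
    (i : ι) (c : α) (ω : Bit V α (N * d) → Bool) : Prop :=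
  d * (1 - p / ℓ) ^ (N * d - d + ℓ) + p ^ 2 * d
    ≤ (zeroCount (G.nbrs L i v c) (G.outerBits L (N * d) i c) ω : ℝ)

/-- The event that too many neighbours of `v` in the `i`-th graph are spoiled. -/
def SpoiledBad [Fintype α] (G : NearlyDisjointSystem V ι N) (L : V → Finset α) (d : ℕ) (p : ℝ)
    (v : V) (i : ι) (c : α) (ω : Bit V α (N * d) → Bool) : Prop :=
  42 * N * p ^ 2 * d ≤ ∑ x, (G.spoiled L (N * d) i v c x ω : ℝ)

/-- The union of the events to be avoided at `v`. -/
def Bad [Fintype α] (G : NearlyDisjointSystem V ι N) (L : V → Finset α) (d ℓ : ℕ) (p : ℝ) (v : V)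
    (ω : Bit V α (N * d) → Bool) : Prop :=
  G.ListBad L d ℓ p v ω ∨ ∃ y ∈ ({i | G.mem i v} : Finset ι) ×ˢ L v,
    G.OuterBad L d ℓ p v y.1 y.2 ω ∨ G.SpoiledBad L d p v y.1 y.2 ω

/-- The vertex `v` and its neighbours sharing a color with it. -/
noncomputable def closedNbrs (G : NearlyDisjointSystem V ι N) (L : V → Finset α) (v : V) :
    Finset V :=
  insert v ((L v).biUnion fun c => G.allNbrs L v c)

/-- The vertices at distance at most two from `v`. -/
noncomputable def closedNbrs₂ (G : NearlyDisjointSystem V ι N) (L : V → Finset α) (v : V) :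
    Finset V :=
  (G.closedNbrs L v).biUnion (G.closedNbrs L)

variable {G : NearlyDisjointSystem V ι N} {L : V → Finset α} {d ℓ : ℕ}

lemma mem_closedNbrs {u v : V} :
    u ∈ G.closedNbrs L v ↔ u = v ∨ ∃ c ∈ L v, (∃ i, G.adj i v u) ∧ c ∈ L u := by
  simp [closedNbrs, mem_allNbrs]

lemma mem_closedNbrs_symm {u v : V} (h : u ∈ G.closedNbrs L v) : v ∈ G.closedNbrs L u := by
  rw [mem_closedNbrs] at h ⊢
  rcases h with rfl | ⟨c, hv, ⟨i, hi⟩, hu⟩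
  · exact Or.inl rfl
  · exact Or.inr ⟨c, hu, ⟨i, G.symm hi⟩, hv⟩

lemma mem_closedNbrs₂_symm {u v : V} (h : u ∈ G.closedNbrs₂ L v) : v ∈ G.closedNbrs₂ L u := by
  obtain ⟨w, hw, hu⟩ := mem_biUnion.1 h
  exact mem_biUnion.2 ⟨w, mem_closedNbrs_symm hu, mem_closedNbrs_symm hw⟩

lemma IsBounded.card_closedNbrs_le (h : G.IsBounded L d ℓ) (v : V) :
    #(G.closedNbrs L v) ≤ ℓ * (N * d) + 1 := by
  refine (card_insert_le _ _).trans (Nat.add_le_add_right ?_ 1)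
  exact (card_biUnion_le_card_mul _ _ _ fun c hc => h.card_allNbrs_le hc).trans
    (Nat.mul_le_mul_right _ (h.card_list_le v))

lemma IsBounded.card_closedNbrs₂_le (h : G.IsBounded L d ℓ) (v : V) :
    #(G.closedNbrs₂ L v) ≤ (ℓ * (N * d) + 1) ^ 2 := by
  rw [sq]
  exact (card_biUnion_le_card_mul _ _ _ fun u _ => h.card_closedNbrs_le u).trans
    (Nat.mul_le_mul_right _ (h.card_closedNbrs_le v))

lemma owner_mem_of_mem_conflictBits {n : ℕ} {u : V} {x : α} (hx : x ∈ L u) {b : Bit V α n}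
    (hb : b ∈ G.conflictBits L n u x) : b.owner ∈ G.closedNbrs L u := by
  rw [mem_closedNbrs]
  rcases mem_union.1 hb with hb | hb
  · obtain ⟨w, hw, rfl⟩ := mem_image.1 hb
    exact Or.inr ⟨x, hx, mem_allNbrs.1 hw⟩
  · obtain ⟨t, _, rfl⟩ := mem_image.1 hb
    exact Or.inl rfl

lemma mem_closedNbrs₂_of_mem_nbrs {i : ι} {u v w : V} {c : α} (hc : c ∈ L v)
    (hu : u ∈ G.nbrs L i v c) (hw : w ∈ G.closedNbrs L u) : w ∈ G.closedNbrs₂ L v :=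
  mem_biUnion.2 ⟨u, mem_closedNbrs.2 (Or.inr ⟨c, hc, ⟨i, (mem_nbrs.1 hu).1⟩, (mem_nbrs.1 hu).2⟩),
    hw⟩

/-- The events at `v` inspect its neighbours, whose conflict bits belong to their own neighbours;
hence distance two. -/
lemma dependsOn_bad [Fintype α] (p : ℝ) (v : V) :
    DependsOn (G.Bad L d ℓ p v) (({b | b.owner ∈ G.closedNbrs₂ L v} :
      Finset (Bit V α (N * d))) : Set (Bit V α (N * d))) := by
  intro ω ω' h
  simp only [coe_filter, mem_univ, true_and, Set.mem_ofPred_eq] at h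
  have hself : ∀ u, u ∈ G.closedNbrs L u := fun u => mem_closedNbrs.2 (Or.inl rfl)
  have h1 : zeroCount (L v) (G.conflictBits L (N * d) v) ω
      = zeroCount (L v) (G.conflictBits L (N * d) v) ω' := by
    refine dependsOn_zeroCount _ _ fun b hb => h b ?_
    obtain ⟨c, hc, hb⟩ := hb
    exact mem_biUnion.2 ⟨v, hself v, owner_mem_of_mem_conflictBits hc hb⟩
  have h2 : ∀ i, ∀ c ∈ L v, zeroCount (G.nbrs L i v c) (G.outerBits L (N * d) i c) ω
      = zeroCount (G.nbrs L i v c) (G.outerBits L (N * d) i c) ω' := by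
    refine fun i c hc => dependsOn_zeroCount _ _ fun b hb => h b ?_
    obtain ⟨u, hu, hb⟩ := hb
    refine mem_closedNbrs₂_of_mem_nbrs hc hu ?_
    rcases mem_union.1 hb with hb | hb
    · exact owner_mem_of_mem_conflictBits (mem_nbrs.1 hu).2 (mem_sdiff.1 hb).1
    · obtain ⟨x, _, rfl⟩ := mem_image.1 hb
      exact hself u
  have h3 : ∀ i, ∀ c ∈ L v, ∀ x, G.spoiled L (N * d) i v c x ω
      = G.spoiled L (N * d) i v c x ω' := by
    intro i c hc x
    refine congrArg card (filter_congr fun u hu => ?_)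
    rw [h (.select u x) (mem_closedNbrs₂_of_mem_nbrs hc hu (hself u))]
    refine and_congr_right fun hx => and_congr Iff.rfl (exists_congr fun b =>
      and_congr_right fun hb => ?_)
    rw [h b (mem_closedNbrs₂_of_mem_nbrs hc hu (owner_mem_of_mem_conflictBits hx hb))]
  simp only [Bad, ListBad, h1]
  congr 1
  refine propext (exists_congr fun y => and_congr_right fun hy => ?_)
  have hy2 := (mem_product.1 hy).2
  simp only [OuterBad, SpoiledBad, h2 _ _ hy2, h3 _ _ hy2]

/-! ### Tail bounds for the bad events -/

section Probability

variable [Fintype α] {p : ℝ}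

lemma IsBounded.prodProb_listBad_le (h : G.IsBounded L d ℓ) (hN : 1 ≤ N) (hp : 0 < p)
    (hp1 : p ≤ 1 / 4) (hℓ : 1 ≤ ℓ) (v : V) :
    prodProb (bitWeight (Bit V α (N * d)) (p / ℓ)) (G.ListBad L d ℓ p v)
      ≤ Real.exp (-(p ^ 3 / (8 * N ^ 3) * d)) := by
  have hℓ' : (1 : ℝ) ≤ ℓ := by exact_mod_cast hℓ
  have hN' : (1 : ℝ) ≤ N := by exact_mod_cast hN
  have h0 : 0 ≤ p / ℓ := by positivity
  have h1 : p / ℓ ≤ 1 := by rw [div_le_one (by linarith)]; linarith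
  have hw := isWeight_bitWeight (Bit V α (N * d)) h0 h1
  by_cases hv : L v = ∅
  · refine le_trans (prodProb_mono hw (Q := fun _ => False) fun ω hω => (hω.1 hv).elim) ?_
    simp only [prodProb, if_false, prodExp_const hw]
    positivity
  have hcard : #(L v) = ℓ := (h.card_list v).resolve_left hv
  have hsum : ∑ c ∈ L v, (1 - p / ℓ) ^ #(G.conflictBits L (N * d) v c)
      = ℓ * (1 - p / ℓ) ^ (N * d) := by
    rw [sum_congr rfl fun c hc => by rw [h.card_conflictBits hc], sum_const, hcard, nsmul_eq_mul]
  have key := prodProb_zeroCount_le h0 h1 (L v) (G.conflictBits L (N * d) v) (k := 1)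
    (fun b => card_mem_conflictBits_le b) (fun c hc => (h.card_conflictBits hc).le)
    (t := p / (2 * N)) (x := p ^ 2 * d) (by positivity)
    (by rw [Nat.cast_one, mul_one, div_le_one (by positivity)]; linarith)
  rw [hsum] at key
  refine (prodProb_mono hw fun ω hω => hω.2).trans (key.trans (Real.exp_le_exp.2 ?_))
  rw [hcard]
  push_cast
  have e : -(p / (2 * N) * (p ^ 2 * d)) + p / ℓ * (p / (2 * N) * 1) ^ 2 * (ℓ * (N * d))
      = -(p ^ 3 * d * (1 / (4 * N))) := by
    field_simp
    ring
  rw [e, neg_le_neg_iff, div_mul_eq_mul_div, div_eq_mul_one_div]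
  refine mul_le_mul_of_nonneg_left (one_div_le_one_div_of_le (by positivity) ?_) (by positivity)
  nlinarith [pow_le_pow_right₀ hN' (show 1 ≤ 3 by norm_num), pow_one (N : ℝ)]

lemma IsBounded.prodProb_outerBad_le (h : G.IsBounded L d ℓ) (hN : 1 ≤ N) (hp : 0 < p)
    (hp1 : p ≤ 1 / 4) (hd : d ≤ ℓ) (hℓ : 1 ≤ ℓ) {v : V} (i : ι) {c : α} (hc : c ∈ L v) :
    prodProb (bitWeight (Bit V α (N * d)) (p / ℓ)) (G.OuterBad L d ℓ p v i c)
      ≤ Real.exp (-(p ^ 3 / (8 * N ^ 3) * d)) := by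
  have hℓ' : (1 : ℝ) ≤ ℓ := by exact_mod_cast hℓ
  have hN' : (1 : ℝ) ≤ N := by exact_mod_cast hN
  have hd' : (d : ℝ) ≤ ℓ := by exact_mod_cast hd
  have h0 : 0 ≤ p / ℓ := by positivity
  have h1 : p / ℓ ≤ 1 := by rw [div_le_one (by linarith)]; linarith
  have hw := isWeight_bitWeight (Bit V α (N * d)) h0 h1
  have hA : (#(G.nbrs L i v c) : ℝ) ≤ d := by exact_mod_cast h.card_nbrs_le i v c hc
  have hsum : ∑ u ∈ G.nbrs L i v c, (1 - p / ℓ) ^ #(G.outerBits L (N * d) i c u)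
      ≤ d * (1 - p / ℓ) ^ (N * d - d + ℓ) := by
    refine (sum_le_card_nsmul _ _ ((1 - p / ℓ) ^ (N * d - d + ℓ)) fun u hu => ?_).trans ?_
    · exact pow_le_pow_of_le_one (by linarith) (by linarith)
        (h.le_card_outerBits (mem_nbrs.1 hu).2)
    · rw [nsmul_eq_mul]
      exact mul_le_mul_of_nonneg_right hA (pow_nonneg (by linarith) _)
  have hN3 : (N : ℝ) ≤ N ^ 3 := by
    nlinarith [pow_le_pow_right₀ hN' (show 1 ≤ 3 by norm_num), pow_one (N : ℝ)]
  -- With influence `N` and at most `2 * N * ℓ` bits per neighbour, this `t` makes the error exactly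
  -- half of the gain `t * x`.
  have key := prodProb_le_zeroCount h0 h1 (G.nbrs L i v c) (G.outerBits L (N * d) i c) (k := N)
    (fun b => card_mem_outerBits_le hN b)
    (fun u hu => h.card_outerBits_le (mem_nbrs.1 hu).2)
    (t := p / (4 * N ^ 3)) (x := p ^ 2 * d) (by positivity)
    (by rw [div_mul_eq_mul_div, div_le_one (by positivity)]; nlinarith)
  refine (prodProb_mono hw fun ω hω => ?_).trans (key.trans (Real.exp_le_exp.2 ?_))
  · exact le_trans (add_le_add hsum le_rfl) hω
  push_cast
  have e1 : p / ℓ * (p / (4 * N ^ 3) * N) ^ 2 * (#(G.nbrs L i v c) * (N * d + ℓ))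
      ≤ p / ℓ * (p / (4 * N ^ 3) * N) ^ 2 * (d * (2 * N * ℓ)) := by
    refine mul_le_mul_of_nonneg_left (mul_le_mul hA ?_ (by positivity) (by positivity))
      (by positivity)
    nlinarith
  have e2 : p / ℓ * (p / (4 * N ^ 3) * N) ^ 2 * (d * (2 * N * ℓ)) = p ^ 3 / (8 * N ^ 3) * d := by
    field_simp
    ring
  have e3 : p / (4 * N ^ 3) * (p ^ 2 * d) = 2 * (p ^ 3 / (8 * N ^ 3) * d) := by
    field_simp
    ring
  linarith

lemma IsBounded.prodProb_spoiledBad_le (h : G.IsBounded L d ℓ) (hN : 1 ≤ N) (hp : 0 < p)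
    (hp1 : p ≤ 1 / 4) (hd : d ≤ ℓ) (hℓ : 1 ≤ ℓ) {v : V} (i : ι) {c : α} (hc : c ∈ L v) :
    prodProb (bitWeight (Bit V α (N * d)) (p / ℓ)) (G.SpoiledBad L d p v i c)
      ≤ Real.exp (-(p ^ 3 / (8 * N ^ 3) * d)) := by
  have hℓ' : (1 : ℝ) ≤ ℓ := by exact_mod_cast hℓ
  have hN' : (1 : ℝ) ≤ N := by exact_mod_cast hN
  have hd' : (d : ℝ) ≤ ℓ := by exact_mod_cast hd
  have h0 : 0 ≤ p / ℓ := by positivity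
  have h1 : p / ℓ ≤ 1 := by rw [div_le_one (by linarith)]; linarith
  have hqd : 2 * (p / ℓ) * d ≤ 1 := by
    rw [mul_div_assoc', div_mul_eq_mul_div, div_le_one (by linarith)]
    nlinarith
  refine (h.prodProb_le_sum_spoiled h0 h1 hqd hc _).trans (Real.exp_le_exp.2 ?_)
  have e1 : 21 * (p / ℓ) ^ 2 * (N * d) * (d * ℓ) = 21 * N * p ^ 2 * d * (d / ℓ) := by
    field_simp
  have e2 : (d : ℝ) / ℓ ≤ 1 := by rwa [div_le_one (by linarith)]
  have e3 : 21 * N * p ^ 2 * d * (d / ℓ) ≤ 21 * N * p ^ 2 * d * 1 :=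
    mul_le_mul_of_nonneg_left e2 (by positivity)
  have e4 : p ^ 3 / (8 * N ^ 3) * d ≤ 21 * N * p ^ 2 * d := by
    refine mul_le_mul_of_nonneg_right ?_ (by positivity)
    refine (div_le_self (by positivity) ?_).trans ?_
    · nlinarith [one_le_pow₀ hN' (n := 3)]
    · have : p ^ 3 ≤ 1 * p ^ 2 := by nlinarith [sq_nonneg p]
      nlinarith [sq_nonneg p]
  linarith

lemma IsBounded.prodProb_bad_le (h : G.IsBounded L d ℓ) (hN : 1 ≤ N) (hp : 0 < p)
    (hp1 : p ≤ 1 / 4) (hd : d ≤ ℓ) (hℓ : 1 ≤ ℓ) (v : V) :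
    prodProb (bitWeight (Bit V α (N * d)) (p / ℓ)) (G.Bad L d ℓ p v)
      ≤ 3 * N * ℓ * Real.exp (-(p ^ 3 / (8 * N ^ 3) * d)) := by
  have hℓ' : (1 : ℝ) ≤ ℓ := by exact_mod_cast hℓ
  have hN' : (1 : ℝ) ≤ N := by exact_mod_cast hN
  have h0 : 0 ≤ p / ℓ := by positivity
  have h1 : p / ℓ ≤ 1 := by rw [div_le_one (by linarith)]; linarith
  have hw := isWeight_bitWeight (Bit V α (N * d)) h0 h1
  set E := Real.exp (-(p ^ 3 / (8 * N ^ 3) * d)) with hE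
  have hE0 : 0 < E := Real.exp_pos _
  refine (prodProb_or_le hw _ _).trans ?_
  have e1 := h.prodProb_listBad_le hN hp hp1 hℓ v
  have e2 : prodProb (bitWeight (Bit V α (N * d)) (p / ℓ)) (fun ω =>
      ∃ y ∈ ({i | G.mem i v} : Finset ι) ×ˢ L v,
        G.OuterBad L d ℓ p v y.1 y.2 ω ∨ G.SpoiledBad L d p v y.1 y.2 ω) ≤ N * ℓ * (2 * E) := by
    refine (prodProb_exists_le hw _ _).trans ((sum_le_card_nsmul _ _ (2 * E) fun y hy => ?_).trans
      ?_)
    · have hy2 := (mem_product.1 hy).2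
      refine (prodProb_or_le hw _ _).trans ?_
      linarith [h.prodProb_outerBad_le hN hp hp1 hd hℓ y.1 hy2,
        h.prodProb_spoiledBad_le hN hp hp1 hd hℓ y.1 hy2]
    · rw [nsmul_eq_mul]
      refine mul_le_mul_of_nonneg_right ?_ (by positivity)
      rw [card_product]
      exact_mod_cast Nat.mul_le_mul (G.card_mem_le v) (h.card_list_le v)
  have e3 : E ≤ N * ℓ * E := le_mul_of_one_le_left hE0.le (one_le_mul_of_one_le_of_one_le hN' hℓ')
  linarith

/-- Two dependent events have a bit owner within distance two of both vertices, so each depends on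
at most `(ℓ * (N * d) + 1) ^ 4` others, itself included. -/
lemma IsBounded.exists_forall_not_bad (h : G.IsBounded L d ℓ) (hN : 1 ≤ N) (hp : 0 < p)
    (hp1 : p ≤ 1 / 4) (hd : d ≤ ℓ) (hℓ : 1 ≤ ℓ)
    (hlarge : 12 * N * ℓ * Real.exp (-(p ^ 3 / (8 * N ^ 3) * d))
      * ((ℓ * (N * d) + 1) ^ 4 : ℕ) ≤ 1) :
    ∃ ω, ∀ v, ¬ G.Bad L d ℓ p v ω := by
  have hℓ' : (1 : ℝ) ≤ ℓ := by exact_mod_cast hℓ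
  have h0 : 0 ≤ p / ℓ := by positivity
  have h1 : p / ℓ ≤ 1 := by rw [div_le_one (by linarith)]; linarith
  have hw := isWeight_bitWeight (Bit V α (N * d)) h0 h1
  have hdep : ∀ v, #{u | ¬ Disjoint
      ({b | b.owner ∈ G.closedNbrs₂ L v} : Finset (Bit V α (N * d)))
      ({b | b.owner ∈ G.closedNbrs₂ L u} : Finset (Bit V α (N * d)))}
      ≤ (ℓ * (N * d) + 1) ^ 4 := by
    intro v
    have hsub : (univ.filter fun u => ¬ Disjoint
        ({b | b.owner ∈ G.closedNbrs₂ L v} : Finset (Bit V α (N * d)))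
        ({b | b.owner ∈ G.closedNbrs₂ L u} : Finset (Bit V α (N * d))))
        ⊆ (G.closedNbrs₂ L v).biUnion (G.closedNbrs₂ L) := by
      intro u hu
      obtain ⟨b, hb, hb'⟩ := not_disjoint_iff.1 (mem_filter.1 hu).2
      exact mem_biUnion.2 ⟨b.owner, (mem_filter.1 hb).2, mem_closedNbrs₂_symm (mem_filter.1 hb').2⟩
    refine (card_le_card hsub).trans ((card_biUnion_le_card_mul _ _ _ fun u _ =>
      h.card_closedNbrs₂_le u).trans ((Nat.mul_le_mul_right _ (h.card_closedNbrs₂_le v)).trans_eq ?_))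
    ring
  obtain ⟨ω, -, hω⟩ := exists_forall_not_of_localLemma hw (G.Bad L d ℓ p)
    (fun v => {b | b.owner ∈ G.closedNbrs₂ L v}) (dependsOn_bad p) _ ((ℓ * (N * d) + 1) ^ 4)
    (h.prodProb_bad_le hN hp hp1 hd hℓ) hdep (Nat.one_le_pow _ _ (Nat.succ_pos _))
    (le_trans (le_of_eq (by ring)) hlarge)
  exact ⟨ω, hω⟩

end Probability

/-- A nibble step: most of the work of coloring can be reduced to a system with smaller color
degrees relative to the list sizes. -/
theorem IsBounded.exists_nibble [Fintype α] {p : ℝ} (h : G.IsBounded L d ℓ) (hN : 1 ≤ N)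
    (hp : 0 < p) (hp1 : p ≤ 1 / 4) (hd : d ≤ ℓ) (hℓ : 1 ≤ ℓ)
    (hlarge : 12 * N * ℓ * Real.exp (-(p ^ 3 / (8 * N ^ 3) * d))
      * ((ℓ * (N * d) + 1) ^ 4 : ℕ) ≤ 1) (hpos : 0 < nextList N d ℓ p) :
    ∃ L' : V → Finset α, G.IsBounded L' ⌊nextDegree N d ℓ p⌋₊ ⌈nextList N d ℓ p⌉₊ ∧
      (G.Colorable L' → G.Colorable L) := by
  obtain ⟨ω, hω⟩ := h.exists_forall_not_bad hN hp hp1 hd hℓ hlarge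
  let keep : V → Finset α := fun v => zeroSet (L v) (G.conflictBits L (N * d) v) ω
  have hkeep : ∀ v, L v ≠ ∅ → ⌈nextList N d ℓ p⌉₊ ≤ #(keep v) := by
    intro v hv
    have := hω v
    simp only [Bad, ListBad, not_or, not_and, not_le] at this
    exact Nat.ceil_le.2 (this.1 hv).le
  let colored : V → Prop := fun v => ∃ x ∈ keep v, ω (.select v x)
  -- Colored vertices leave the system by receiving an empty list; the other nonempty lists are
  -- trimmed to a common size, as `IsBounded` demands.
  have hex : ∀ v, ∃ S : Finset α, S ⊆ keep v ∧
      (colored v ∨ L v = ∅ → S = ∅) ∧ (¬ (colored v ∨ L v = ∅) → #S = ⌈nextList N d ℓ p⌉₊) := by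
    intro v
    by_cases hv : colored v ∨ L v = ∅
    · exact ⟨∅, empty_subset _, fun _ => rfl, fun h => absurd hv h⟩
    · obtain ⟨S, hS, hcard⟩ := exists_subset_card_eq (hkeep v fun h => hv (Or.inr h))
      exact ⟨S, hS, fun h => absurd h hv, fun _ => hcard⟩
  choose L' hL'sub hL'emp hL'card using hex
  have hunc : ∀ v, ∀ c ∈ L' v, ¬ colored v := fun v c hc hv => by
    rw [hL'emp v (Or.inl hv)] at hc
    simp at hc
  have hselect : ∀ i u v x, G.adj i u v → x ∈ keep u → x ∈ L v → ω (.select v x) = false := by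
    intro i u v x huv hxu hxv
    exact (mem_zeroSet.1 hxu).2 _ (select_mem_conflictBits.2 ⟨mem_allNbrs.2 ⟨⟨i, huv⟩, hxv⟩, rfl⟩)
  refine ⟨L', ⟨fun v => ?_, fun i v c hc => ?_⟩, ?_⟩
  · by_cases hv : colored v ∨ L v = ∅
    · exact Or.inl (hL'emp v hv)
    · exact Or.inr (hL'card v hv)
  · have hcv : c ∈ L v := (mem_zeroSet.1 (hL'sub v hc)).1
    rcases (G.nbrs L' i v c).eq_empty_or_nonempty with he | ⟨u₀, hu₀⟩
    · simp [he]
    have hiv : G.mem i v := G.mem_left (mem_nbrs.1 hu₀).1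
    have hb := hω v
    simp only [Bad, not_or, not_exists, not_and] at hb
    have hb2 := hb.2 (i, c) (mem_product.2 ⟨by simpa using hiv, hcv⟩)
    simp only [OuterBad, SpoiledBad, not_le] at hb2
    have hsub : G.nbrs L' i v c ⊆
        zeroSet (G.nbrs L i v c) (G.outerBits L (N * d) i c) ω ∪
        univ.biUnion fun x => G.spoiledSet L (N * d) i v c x ω := by
      intro u hu
      obtain ⟨huv, hcu⟩ := mem_nbrs.1 hu
      have hku := hL'sub u hcu
      have hu' : u ∈ G.nbrs L i v c := mem_nbrs.2 ⟨huv, (mem_zeroSet.1 hku).1⟩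
      rw [mem_union]
      -- As `u` is uncolored, any color it selected failed to survive, so `u` is spoiled; if it
      -- selected none, all its outer bits are `false`.
      by_cases hsel : ∃ x ∈ L u, ω (.select u x)
      · obtain ⟨x, hx, hωx⟩ := hsel
        refine Or.inr (mem_biUnion.2 ⟨x, mem_univ x, mem_spoiledSet.2 ⟨hu', hx, hωx, ?_⟩⟩)
        by_contra! hcon
        exact hunc u c hcu ⟨x, mem_zeroSet.2 ⟨hx, fun b hb => by simpa using hcon b hb⟩, hωx⟩
      · push Not at hsel
        refine Or.inl (mem_zeroSet.2 ⟨hu', fun b hb => ?_⟩)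
        rcases mem_union.1 hb with hb | hb
        · exact (mem_zeroSet.1 hku).2 b (mem_sdiff.1 hb).1
        · obtain ⟨x, hx, rfl⟩ := mem_image.1 hb
          simpa using hsel x hx
    have hcard : #(G.nbrs L' i v c) ≤ zeroCount (G.nbrs L i v c) (G.outerBits L (N * d) i c) ω
        + ∑ x, G.spoiled L (N * d) i v c x ω :=
      (card_le_card hsub).trans ((card_union_le _ _).trans (add_le_add le_rfl card_biUnion_le))
    refine Nat.le_floor ?_
    have hcard' : (#(G.nbrs L' i v c) : ℝ)
        ≤ zeroCount (G.nbrs L i v c) (G.outerBits L (N * d) i c) ω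
          + ∑ x, (G.spoiled L (N * d) i v c x ω : ℝ) := by exact_mod_cast hcard
    rw [nextDegree]
    linarith
  · rintro ⟨φ, hφ, hφ'⟩
    have hposn : 0 < ⌈nextList N d ℓ p⌉₊ := Nat.ceil_pos.2 hpos
    have hne : ∀ v, ¬ colored v → L v ≠ ∅ → L' v ≠ ∅ := fun v hv hL he => by
      have := hL'card v (not_or.2 ⟨hv, hL⟩)
      rw [he, card_empty] at this
      omega
    let ψ : V → α := fun v => if hv : colored v then hv.choose else φ v
    have hψ1 : ∀ v, colored v → ψ v ∈ keep v ∧ ω (.select v (ψ v)) := fun v hv => by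
      simp only [ψ, hv, dif_pos]
      exact hv.choose_spec
    have hψ2 : ∀ v, ¬ colored v → ψ v = φ v := fun v hv => by simp [ψ, hv]
    have hψk : ∀ v, L v ≠ ∅ → ψ v ∈ keep v := fun v hL => by
      by_cases hv : colored v
      · exact (hψ1 v hv).1
      · rw [hψ2 v hv]
        exact hL'sub v (hφ v (hne v hv hL))
    refine ⟨ψ, fun v hv => (mem_zeroSet.1 (hψk v hv)).1, fun i u v huv hu hv heq => ?_⟩
    by_cases cv : colored v
    · have := hselect i u v (ψ v) huv (heq ▸ hψk u hu) (mem_zeroSet.1 (hψk v hv)).1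
      rw [(hψ1 v cv).2] at this
      exact Bool.noConfusion this
    · by_cases cu : colored u
      · have := hselect i v u (ψ u) (G.symm huv) (heq ▸ hψk v hv) (mem_zeroSet.1 (hψk u hu)).1
        rw [(hψ1 u cu).2] at this
        exact Bool.noConfusion this
      · rw [hψ2 u cu, hψ2 v cv] at heq
        exact hφ' i u v huv (hne u cu hu) (hne v cv hv) heq

end NearlyDisjointSystem

namespace NearlyDisjointSystem

/-! ### Iterating the nibble -/

/-- Here `y` and `z` are the survival factors outside and inside one graph, and `u` is the
probability of selecting nothing. The gain `p * η = 200 * n * p ^ 2`, halved by `y ≥ 1 / 2`, leaves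
at least `99.5 * n * p ^ 2`, against losses of at most `88 * n * p ^ 2`. -/
lemma surviving_ratio {n p η y z u : ℝ} (hn : 1 ≤ n) (hpp : p ^ 2 ≤ 1 / 200)
    (hη : η = 200 * n * p) (hy : 1 / 2 ≤ y) (hy1 : y ≤ 1) (hu0 : 0 ≤ u) (hu : u ≤ 1 - p + p ^ 2)
    (hu1 : u ≤ 1) (hz : 1 - p * (1 - η) ≤ z) :
    (1 + p ^ 2) * (y * u + 43 * n * p ^ 2) ≤ y * z - p ^ 2 := by
  have hyu : y * u ≤ 1 := mul_le_one₀ hy1 hu0 hu1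
  have hnp : p ^ 2 ≤ n * p ^ 2 := le_mul_of_one_le_left (sq_nonneg p) hn
  have h1 : p ^ 2 * (y * u) ≤ p ^ 2 * 1 := mul_le_mul_of_nonneg_left hyu (sq_nonneg p)
  have h2 : p ^ 2 * (43 * n * p ^ 2) ≤ 1 * (43 * n * p ^ 2) :=
    mul_le_mul_of_nonneg_right (by linarith) (by positivity)
  have h3 : p * η = 200 * (n * p ^ 2) := by rw [hη]; ring
  have h4 : 199 * (n * p ^ 2) ≤ z - u := by linarith
  have h5 : 1 / 2 * (199 * (n * p ^ 2)) ≤ y * (z - u) :=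
    mul_le_mul hy h4 (by positivity) (by linarith)
  linarith [sq_nonneg p]

/-- In a nibble step the ratio between the list sizes and the color degrees grows by the factor
`1 + p ^ 2`, while the lists shrink at most by the factor `4`. -/
lemma nextDegree_nextList_bounds {N d ℓ : ℕ} {ε p : ℝ} (hN : 1 ≤ N) (hε : 0 < ε)
    (hp : p = ε / (1 + ε) / (200 * N)) (hℓ : 1 ≤ ℓ) (hd : (1 + ε) * d ≤ ℓ) :
    (ℓ : ℝ) / 4 ≤ nextList N d ℓ p ∧
      (1 + p ^ 2) * nextDegree N d ℓ p * ℓ ≤ nextList N d ℓ p * d := by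
  have hℓ' : (1 : ℝ) ≤ ℓ := by exact_mod_cast hℓ
  have hN' : (1 : ℝ) ≤ N := by exact_mod_cast hN
  have hd0 : (0 : ℝ) ≤ d := by positivity
  have hdℓ : (d : ℝ) ≤ ℓ := by nlinarith
  set η := ε / (1 + ε) with hη
  have hη0 : 0 < η := by positivity
  have hη1 : η ≤ 1 := by rw [hη, div_le_one (by linarith)]; linarith
  have hpη : η = 200 * N * p := by rw [hp]; field_simp
  have hp0 : 0 < p := by rw [hp]; positivity
  have hNp : N * p ≤ 1 / 200 := by nlinarith
  have hp1 : p ≤ 1 / 200 := by nlinarith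
  have hq0 : 0 ≤ p / ℓ := by positivity
  have hq1 : p / ℓ ≤ 1 := by rw [div_le_one (by linarith)]; linarith
  have hratio : (d : ℝ) / ℓ ≤ 1 - η := by
    have : 1 - η = 1 / (1 + ε) := by rw [hη]; field_simp; ring
    rw [this, div_le_div_iff₀ (by linarith) (by linarith)]
    linarith
  have bern : ∀ n : ℕ, 1 - n * (p / ℓ) ≤ (1 - p / ℓ) ^ n := fun n => by
    have := one_add_mul_le_pow (a := -(p / ℓ)) (by linarith) n
    rw [← sub_eq_add_neg] at this
    linarith
  have hsub : d ≤ N * d := Nat.le_mul_of_pos_left d hN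
  set y := (1 - p / ℓ) ^ (N * d - d) with hy
  set z := (1 - p / ℓ) ^ d with hz
  set u := (1 - p / ℓ) ^ ℓ with hu
  have hyz : (1 - p / ℓ) ^ (N * d) = y * z := by rw [hy, hz, ← pow_add, Nat.sub_add_cancel hsub]
  have hyu : (1 - p / ℓ) ^ (N * d - d + ℓ) = y * u := by rw [hy, hu, ← pow_add]
  have hz1 : 1 - p * (1 - η) ≤ z := by
    have e : (d : ℝ) * (p / ℓ) = p * (d / ℓ) := by ring
    have := bern d
    rw [e] at this
    nlinarith
  have hy1 : 1 / 2 ≤ y := by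
    have e := bern (N * d - d)
    have e2 : ((N * d - d : ℕ) : ℝ) * (p / ℓ) ≤ N * p := by
      have e3 : ((N * d - d : ℕ) : ℝ) ≤ N * ℓ := by
        have : ((N * d - d : ℕ) : ℝ) ≤ ((N * d : ℕ) : ℝ) := by exact_mod_cast Nat.sub_le _ _
        push_cast at this
        nlinarith
      calc ((N * d - d : ℕ) : ℝ) * (p / ℓ) ≤ N * ℓ * (p / ℓ) := by gcongr
        _ = N * p := by field_simp
    linarith
  have hy2 : y ≤ 1 := pow_le_one₀ (by linarith) (by linarith)
  have hu0 : 0 ≤ u := pow_nonneg (by linarith) _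
  have hu1 : u ≤ 1 - p + p ^ 2 := by
    have e1 : u ≤ Real.exp (-p) := by
      have : 1 - p / ℓ ≤ Real.exp (-(p / ℓ)) := by linarith [Real.add_one_le_exp (-(p / ℓ))]
      calc u ≤ Real.exp (-(p / ℓ)) ^ ℓ := pow_le_pow_left₀ (by linarith) this ℓ
        _ = Real.exp (-p) := by
          rw [← Real.exp_nat_mul]
          congr 1
          field_simp
    have e2 := (abs_le.1 (Real.abs_exp_sub_one_sub_id_le (x := -p)
      (by rw [abs_neg, abs_of_pos hp0]; linarith))).2
    linarith [neg_sq p]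
  have hu2 : u ≤ 1 := pow_le_one₀ (by linarith) (by linarith)
  have hz2 : 1 - p ≤ z := by nlinarith
  have hpp : p ^ 2 ≤ 1 / 200 := by nlinarith
  rw [nextList, nextDegree, hyz, hyu]
  constructor
  · have : 1 / 4 ≤ y * z - p ^ 2 := by
      have := mul_le_mul hy1 hz2 (by linarith) (by linarith)
      linarith
    have h2 : p ^ 2 * d ≤ p ^ 2 * ℓ := mul_le_mul_of_nonneg_left hdℓ (sq_nonneg p)
    have h3 := mul_le_mul_of_nonneg_left this (by linarith : (0 : ℝ) ≤ ℓ)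
    linarith
  · have e1 := surviving_ratio hN' hpp hpη hy1 hy2 hu0 hu1 hu2 hz1
    have e3 : d * (y * u) + p ^ 2 * d + 42 * N * p ^ 2 * d ≤ d * (y * u + 43 * N * p ^ 2) := by
      have : p ^ 2 * d ≤ N * p ^ 2 * d := by
        refine mul_le_mul_of_nonneg_right ?_ hd0
        nlinarith [sq_nonneg p]
      linarith
    calc (1 + p ^ 2) * (d * (y * u) + p ^ 2 * d + 42 * N * p ^ 2 * d) * ℓ
        ≤ (1 + p ^ 2) * (d * (y * u + 43 * N * p ^ 2)) * ℓ := by gcongr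
      _ = (1 + p ^ 2) * (y * u + 43 * N * p ^ 2) * (d * ℓ) := by ring
      _ ≤ (y * z - p ^ 2) * (d * ℓ) :=
          mul_le_mul_of_nonneg_right e1 (by positivity)
      _ ≤ (ℓ * (y * z) - p ^ 2 * d) * d := by
          have : p ^ 2 * d * d ≤ p ^ 2 * ℓ * d := by gcongr
          linarith

/-- Outside the sparse range `d` is at least a constant multiple of `ℓ`, so the exponential in `d`
beats the polynomial of degree 9 in `ℓ`. -/
lemma exists_forall_localLemma_condition (N : ℕ) (hN : 1 ≤ N) {κ : ℝ} (hκ : 0 < κ) :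
    ∃ M : ℕ, ∀ d ℓ : ℕ, M ≤ ℓ → 1 ≤ ℓ → d ≤ ℓ → ℓ ≤ 32 * (N * d) →
      12 * N * ℓ * Real.exp (-(κ * d)) * ((ℓ * (N * d) + 1) ^ 4 : ℕ) ≤ 1 := by
  have hN' : (1 : ℝ) ≤ N := by exact_mod_cast hN
  have hκ' : 0 < κ / (32 * N) := by positivity
  have hev := (isLittleO_pow_exp_pos_mul_atTop 9 hκ').def
    (c := 1 / (192 * N ^ 5)) (by positivity)
  obtain ⟨x₀, hx₀⟩ := Filter.eventually_atTop.1 hev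
  refine ⟨⌈x₀⌉₊, fun d ℓ hM hℓ hd hdℓ => ?_⟩
  have hℓ' : (1 : ℝ) ≤ ℓ := by exact_mod_cast hℓ
  have hx := hx₀ ℓ (Nat.ceil_le.1 hM)
  rw [Real.norm_of_nonneg (by positivity), Real.norm_of_nonneg (by positivity)] at hx
  have hexp : Real.exp (-(κ * d)) ≤ Real.exp (-(κ / (32 * N) * ℓ)) := by
    rw [Real.exp_le_exp, neg_le_neg_iff, div_mul_eq_mul_div, div_le_iff₀ (by positivity)]
    have : (ℓ : ℝ) ≤ 32 * (N * d) := by exact_mod_cast hdℓ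
    nlinarith
  have hpow : (((ℓ * (N * d) + 1) ^ 4 : ℕ) : ℝ) ≤ 16 * N ^ 4 * ℓ ^ 8 := by
    have h1 : ℓ * (N * d) + 1 ≤ 2 * N * ℓ ^ 2 := by
      have h2 : ℓ * (N * d) ≤ ℓ * (N * ℓ) := by gcongr
      have h3 : 1 ≤ ℓ * (N * ℓ) := Nat.mul_pos hℓ (Nat.mul_pos hN hℓ)
      calc ℓ * (N * d) + 1 ≤ ℓ * (N * ℓ) + ℓ * (N * ℓ) := add_le_add h2 h3
        _ = 2 * N * ℓ ^ 2 := by ring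
    have h4 : (ℓ * (N * d) + 1) ^ 4 ≤ 16 * N ^ 4 * ℓ ^ 8 :=
      (Nat.pow_le_pow_left h1 4).trans_eq (by ring)
    exact_mod_cast h4
  calc 12 * N * ℓ * Real.exp (-(κ * d)) * ((ℓ * (N * d) + 1) ^ 4 : ℕ)
      ≤ 12 * N * ℓ * Real.exp (-(κ / (32 * N) * ℓ)) * (16 * N ^ 4 * ℓ ^ 8) := by gcongr
    _ = 192 * N ^ 5 * (ℓ : ℝ) ^ 9 * Real.exp (-(κ / (32 * N) * ℓ)) := by ring
    _ ≤ 192 * N ^ 5 * (1 / (192 * N ^ 5) * Real.exp (κ / (32 * N) * ℓ))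
          * Real.exp (-(κ / (32 * N) * ℓ)) := by gcongr
    _ = 1 := by
        rw [Real.exp_neg]
        field_simp

universe u₁ u₂ u₃

/-- Here `k` bounds the number of nibble steps still needed. The threshold `M` depends on `N`, `ε`,
`k` only and is enlarged at each induction step because a nibble may divide list sizes by 4. -/
theorem exists_forall_colorable (N : ℕ) (hN : 1 ≤ N) {ε p : ℝ} (hε : 0 < ε)
    (hp : p = ε / (1 + ε) / (200 * N)) (k : ℕ) :
    ∃ M : ℕ, ∀ d ℓ : ℕ, M ≤ ℓ → (1 + ε) * d ≤ ℓ → 32 * N * d ≤ (1 + p ^ 2) ^ k * ℓ →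
      ∀ (V : Type u₁) (ι : Type u₂) (α : Type u₃) [Fintype V] [Fintype ι] [Fintype α] [Nonempty α]
        (G : NearlyDisjointSystem V ι N) (L : V → Finset α), G.IsBounded L d ℓ →
        G.Colorable L := by
  have hN' : (1 : ℝ) ≤ N := by exact_mod_cast hN
  have hp0 : 0 < p := by rw [hp]; positivity
  have hp1 : p ≤ 1 / 4 := by
    rw [hp, div_div, div_le_div_iff₀ (by positivity) (by norm_num)]
    nlinarith
  induction k with
  | zero =>
    refine ⟨3, fun d ℓ hM _ hr V ι α _ _ _ _ G L hL => hL.colorable_of_sparse hM ?_⟩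
    rw [pow_zero, one_mul, mul_assoc] at hr
    exact_mod_cast hr
  | succ k ih =>
    obtain ⟨M₁, hM₁⟩ := ih
    obtain ⟨M₂, hM₂⟩ := exists_forall_localLemma_condition N hN
      (κ := p ^ 3 / (8 * N ^ 3)) (by positivity)
    refine ⟨max 3 (max (4 * M₁) M₂), fun d ℓ hM hd hr V ι α _ _ _ _ G L hL => ?_⟩
    simp only [max_le_iff] at hM
    obtain ⟨h3, h4, h5⟩ := hM
    -- Stopping early is necessary: if `d` is small compared with `ℓ`, the concentration bounds are
    -- too weak for another step.
    by_cases hsparse : 32 * (N * d) ≤ ℓ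
    · exact hL.colorable_of_sparse h3 hsparse
    have hℓ' : (3 : ℝ) ≤ ℓ := by exact_mod_cast h3
    have hdℓ : d ≤ ℓ := by
      have : (d : ℝ) ≤ ℓ := by nlinarith [(Nat.cast_nonneg d : (0 : ℝ) ≤ d)]
      exact_mod_cast this
    obtain ⟨hb1, hb2⟩ := nextDegree_nextList_bounds hN hε hp (by omega : 1 ≤ ℓ) hd
    have hpos : 0 < nextList N d ℓ p := by linarith
    obtain ⟨L', hL', hcol⟩ := hL.exists_nibble hN hp0 hp1 hdℓ (by omega)
      (hM₂ d ℓ h5 (by omega) hdℓ (by omega)) hpos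
    refine hcol (hM₁ _ _ ?_ ?_ ?_ V ι α G L' hL')
    all_goals
      have hle : nextList N d ℓ p ≤ ⌈nextList N d ℓ p⌉₊ := Nat.le_ceil _
      have hdeg0 : 0 ≤ nextDegree N d ℓ p := by
        have : 0 ≤ 1 - p / ℓ := by
          rw [sub_nonneg, div_le_one (by linarith)]
          linarith
        rw [nextDegree]
        positivity
      have hfl : (⌊nextDegree N d ℓ p⌋₊ : ℝ) ≤ nextDegree N d ℓ p := Nat.floor_le hdeg0
      -- Rounding degrees down and list sizes up only improves the ratio.
      have hratio : (1 + p ^ 2) * ⌊nextDegree N d ℓ p⌋₊ * ℓ ≤ ⌈nextList N d ℓ p⌉₊ * d :=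
        calc _ ≤ (1 + p ^ 2) * nextDegree N d ℓ p * ℓ := by gcongr
          _ ≤ nextList N d ℓ p * d := hb2
          _ ≤ _ := by gcongr
      have hfl0 : (0 : ℝ) ≤ ⌊nextDegree N d ℓ p⌋₊ := Nat.cast_nonneg _
      have hce0 : (0 : ℝ) ≤ ⌈nextList N d ℓ p⌉₊ := Nat.cast_nonneg _
    · have : (4 * M₁ : ℝ) ≤ ℓ := by exact_mod_cast h4
      have : (M₁ : ℝ) ≤ ⌈nextList N d ℓ p⌉₊ := by linarith
      exact_mod_cast this
    · refine le_of_mul_le_mul_right ?_ (by linarith : (0 : ℝ) < ℓ)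
      calc (1 + ε) * (⌊nextDegree N d ℓ p⌋₊ : ℝ) * ℓ
          ≤ (1 + ε) * ((1 + p ^ 2) * ⌊nextDegree N d ℓ p⌋₊ * ℓ) := by
            rw [mul_assoc]
            refine mul_le_mul_of_nonneg_left (mul_le_mul_of_nonneg_right ?_ (by linarith))
              (by linarith)
            nlinarith [sq_nonneg p]
        _ ≤ (1 + ε) * (⌈nextList N d ℓ p⌉₊ * d) := by gcongr
        _ = ⌈nextList N d ℓ p⌉₊ * ((1 + ε) * d) := by ring
        _ ≤ ⌈nextList N d ℓ p⌉₊ * ℓ := by gcongr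
    · have hpos2 : (0 : ℝ) < (1 + p ^ 2) * ℓ := by positivity
      refine le_of_mul_le_mul_right ?_ hpos2
      calc (32 : ℝ) * N * (⌊nextDegree N d ℓ p⌋₊ : ℝ) * ((1 + p ^ 2) * ℓ)
          = (32 : ℝ) * N * ((1 + p ^ 2) * ⌊nextDegree N d ℓ p⌋₊ * ℓ) := by ring
        _ ≤ (32 : ℝ) * N * (⌈nextList N d ℓ p⌉₊ * d) := by gcongr
        _ = (⌈nextList N d ℓ p⌉₊ : ℝ) * (32 * N * d) := by ring
        _ ≤ ⌈nextList N d ℓ p⌉₊ * ((1 + p ^ 2) ^ (k + 1) * ℓ) := by gcongr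
        _ = (1 + p ^ 2) ^ k * ⌈nextList N d ℓ p⌉₊ * ((1 + p ^ 2) * ℓ) := by ring

end NearlyDisjointSystem

/-! ### Reduction of the theorem to nearly disjoint systems -/

lemma colorDegree_le_maxColorDegree {V α : Type*} {H : (⊤ : SimpleGraph V).Subgraph}
    (hH : H.verts.Finite) {L : V → Finset α} {v : V} (hv : v ∈ H.verts) {c : α} (hc : c ∈ L v) :
    colorDegree H L v c ≤ maxColorDegree H L := by
  -- An unbounded supremum in `ℕ` would be 0, so a bound must be supplied; it comes from finiteness
  -- of the vertex set.
  refine le_csSup ⟨H.verts.ncard, ?_⟩ ⟨v, hv, c, hc, rfl⟩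
  rintro _ ⟨v, _, c, _, rfl⟩
  exact Set.ncard_le_ncard (fun u hu => H.edge_vert hu.1.symm) hH

/-- The system on a set `W` of vertices formed by a nearly disjoint family of graphs. -/
def NearlyDisjointSystem.ofSubgraphs {V : Type*} {m N : ℕ}
    (G : Fin m → (⊤ : SimpleGraph V).Subgraph) (hG : NearlyDisjoint G) (W : Set V)
    (hN : ∀ v ∈ W, {i | v ∈ (G i).verts}.ncard ≤ N) : NearlyDisjointSystem W (Fin m) N where
  mem i v := (v : V) ∈ (G i).verts
  adj i u v := (G i).Adj u v
  symm h := h.symm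
  irrefl i v h := h.ne rfl
  mem_left h := h.fst_mem
  eq_of_mem {i j u v} hij hiu hju hiv hjv :=
    Subtype.ext (Set.encard_le_one_iff.1 (hG i j hij) u v ⟨hiu, hju⟩ ⟨hiv, hjv⟩)
  card_mem_le v := by
    refine le_trans (le_of_eq ?_) (hN v v.2)
    rw [← Set.ncard_coe_finset]
    simp

end

theorem theorem1p3 (C ε : ℝ) (hC : 0 < C) (hε : 0 < ε) :
    ∃ D₀ : ℝ, ∀ D : ℝ, D₀ ≤ D →
      ∀ (V : Type*) (α : Type*) (m : ℕ) (G : Fin m → (⊤ : SimpleGraph V).Subgraph)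
        (L : V → Finset α),
        (∀ i, (G i).verts.Finite) →
        NearlyDisjoint G →
        (∀ v ∈ (⨆ i, G i).verts, ({i | v ∈ (G i).verts}.ncard : ℝ) ≤ C) →
        (∀ i, (maxColorDegree (G i) L : ℝ) ≤ D) →
        (∀ v ∈ (⨆ i, G i).verts, (1 + ε) * D ≤ ((L v).card : ℝ)) →
        IsListColorable (⨆ i, G i) L := by
  classical
  set N := max 1 ⌊C⌋₊ with hNdef
  have hN : 1 ≤ N := le_max_left _ _
  set p : ℝ := ε / (1 + ε) / (200 * N) with hp
  have hp0 : 0 < p := by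
    have : (1 : ℝ) ≤ N := by exact_mod_cast hN
    positivity
  -- The number of steps depends only on `N` and `p`, so it is fixed before `D`; since `d ≤ ℓ`, this
  -- `k` meets the ratio condition.
  obtain ⟨k, hk⟩ := pow_unbounded_of_one_lt (32 * N : ℝ)
    (show 1 < 1 + p ^ 2 by linarith [pow_pos hp0 2])
  obtain ⟨M, hM⟩ := NearlyDisjointSystem.exists_forall_colorable N hN hε hp k
  refine ⟨max 1 M, fun D hD V α m G L hfin hG hmult hdeg hlist => ?_⟩
  have hD1 : 1 ≤ D := (le_max_left _ _).trans hD
  have hDM : (M : ℝ) ≤ D := (le_max_right _ _).trans hD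
  set d := ⌊D⌋₊ with hd
  set ℓ := ⌈(1 + ε) * D⌉₊ with hℓ
  have hdD : (d : ℝ) ≤ D := Nat.floor_le (by linarith)
  have hDℓ : (1 + ε) * D ≤ ℓ := Nat.le_ceil _
  have hℓ0 : 0 < ℓ := Nat.ceil_pos.2 (by positivity)
  have hDℓ' : D ≤ ℓ := by nlinarith
  set W := (⨆ i, G i).verts with hW
  have hWfin : W.Finite := by
    rw [hW, SimpleGraph.Subgraph.verts_iSup]
    exact Set.finite_iUnion hfin
  have : Fintype W := hWfin.fintype
  have hsub : ∀ v : W, ∃ S ⊆ L v, S.card = ℓ := fun v =>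
    Finset.exists_subset_card_eq (Nat.ceil_le.2 (hlist v v.2))
  choose S hSL hScard using hsub
  -- The color type may be infinite; the finitely many colors of the trimmed lists form a finite
  -- palette.
  let P : Finset α := Finset.univ.biUnion S
  have hSP : ∀ v, ∀ c ∈ S v, c ∈ P := fun v c hc =>
    Finset.mem_biUnion.2 ⟨v, Finset.mem_univ v, hc⟩
  let G' := NearlyDisjointSystem.ofSubgraphs G hG W (N := N) fun v hv =>
    (Nat.le_floor (hmult v hv)).trans (le_max_right _ _)
  let L' : W → Finset P := fun v => (S v).subtype (· ∈ P)
  have hL' : G'.IsBounded L' d ℓ := by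
    refine ⟨fun v => Or.inr ?_, fun i v c hc => ?_⟩
    · rw [Finset.card_subtype, Finset.filter_true_of_mem (hSP v), hScard]
    · have hcS : (c : α) ∈ L v := hSL v (Finset.mem_subtype.1 hc)
      by_cases hv : (v : V) ∈ (G i).verts
      · refine Nat.le_floor (le_trans ?_ (hdeg i))
        have h1 := colorDegree_le_maxColorDegree (hfin i) hv hcS
        refine Nat.cast_le.2 (le_trans ?_ h1)
        rw [← Finset.card_image_of_injective _ Subtype.val_injective, ← Set.ncard_coe_finset]
        refine Set.ncard_le_ncard (fun u hu => ?_)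
          ((hfin i).subset fun u hu => (G i).edge_vert hu.1.symm)
        obtain ⟨u, hnbr, rfl⟩ := Finset.mem_image.1 (Finset.mem_coe.1 hu)
        obtain ⟨hadj, hcu⟩ := NearlyDisjointSystem.mem_nbrs.1 hnbr
        exact ⟨hadj, hSL u (Finset.mem_subtype.1 hcu)⟩
      · refine le_of_eq_of_le (Finset.card_eq_zero.2 (Finset.eq_empty_of_forall_notMem ?_))
          (Nat.zero_le d)
        intro u hu
        exact hv (SimpleGraph.Subgraph.Adj.fst_mem (NearlyDisjointSystem.mem_nbrs.1 hu).1)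
  have hne : ∀ v, L' v ≠ ∅ := fun v he => by
    have h2 := congrArg Finset.card he
    rw [Finset.card_subtype, Finset.filter_true_of_mem (hSP v), hScard, Finset.card_empty] at h2
    omega
  -- With no vertices the palette is empty, which the iteration theorem excludes.
  rcases isEmpty_or_nonempty W with hWe | ⟨⟨v₀⟩⟩
  · exact ⟨SimpleGraph.Coloring.mk (fun v => (hWe.false v).elim) fun {v} => (hWe.false v).elim,
      fun v => (hWe.false v).elim⟩
  obtain ⟨c₀, -⟩ := Finset.nonempty_iff_ne_empty.2 (hne v₀)
  have : Nonempty P := ⟨c₀⟩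
  have hMℓ : M ≤ ℓ := by
    have : (M : ℝ) ≤ ℓ := hDM.trans hDℓ'
    exact_mod_cast this
  obtain ⟨φ, hφ, hφ'⟩ := hM d ℓ hMℓ ((mul_le_mul_of_nonneg_left hdD (by linarith)).trans hDℓ)
    (mul_le_mul hk.le (hdD.trans hDℓ') (Nat.cast_nonneg _) (by positivity)) W (Fin m) P G' L' hL'
  refine ⟨SimpleGraph.Coloring.mk (fun v => (φ v : α)) fun {u v} huv heq => ?_, fun v => ?_⟩
  · obtain ⟨i, hi⟩ := SimpleGraph.Subgraph.iSup_adj.1 huv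
    exact hφ' i u v hi (hne u) (hne v) (Subtype.ext heq)
  · exact hSL v (Finset.mem_subtype.1 (hφ v (hne v)))
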